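/- **Biquandles and brackets.** A biquandle is a set $X$ with operations $\underline{\triangleright},\overline{\triangleright}:X\times X\to X$ such that for all $x,y,z\in X$: $x\,\underline{\triangleright}\,x=x\,\overline{\triangleright}\,x$; the maps $x\mapsto x\,\overline{\triangleright}\,y$, $x\mapsto x\,\underline{\triangleright}\,y$ and $(x,y)\mapsto(y\,\overline{\triangleright}\,x,\;x\,\underline{\triangleright}\,y)$ are bijective; and $$(x\underline{\triangleright}y)\underline{\triangleright}(z\underline{\triangleright}y)=(x\underline{\triangleright}z)\underline{\triangleright}(y\overline{\triangleright}z),\quad (x\underline{\triangleright}y)\overline{\triangleright}(z\underline{\triangleright}y)=(x\overline{\triangleright}z)\underline{\triangleright}(y\overline{\triangleright}z),\quad (x\overline{\triangleright}y)\overline{\triangleright}(z\overline{\triangleright}y)=(x\overline{\triangleright}z)\overline{\triangleright}(y\underline{\triangleright}z).$$ Let $X$ be a finite biquandle and $R$ a commutative ring with identity. An $X$-bracket $\beta$ over $R$ consists of maps $A,B:X\times X\to R^\times$ and elements $\delta\in R$, $w\in R^\times$ such that for all $x,y,z\in X$: $\delta A_{x,x}+B_{x,x}=w$ and $\delta A_{x,x}^{-1}+B_{x,x}^{-1}=w^{-1}$;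 $\delta=-A_{x,y}B_{x,y}^{-1}-A_{x,y}^{-1}B_{x,y}$; and, writing $p=(x,y)$, $q=(y,z)$, $r=(x\underline{\triangleright}y,z\overline{\triangleright}y)$, $p'=(x,z)$, $q'=(y\overline{\triangleright}x,z\overline{\triangleright}x)$, $r'=(x\underline{\triangleright}z,y\underline{\triangleright}z)$, $$A_pA_qA_r=A_{p'}A_{q'}A_{r'},\qquad A_pB_qB_r=B_{p'}B_{q'}A_{r'},\qquad B_pA_qB_r=B_{p'}A_{q'}B_{r'},$$ $$A_pA_qB_r=A_{p'}B_{q'}A_{r'}+A_{p'}A_{q'}B_{r'}+\delta A_{p'}B_{q'}B_{r'}+B_{p'}B_{q'}B_{r'},$$ $$B_pA_qA_r+A_pB_qA_r+\delta B_pB_qA_r+B_pB_qB_r=B_{p'}A_{q'}A_{r'}.$$ **Diagrams and colorings.** An oriented link diagram is taken combinatorially: finitely many signed crossings, each with an over- and an under-strand, whose ends are connected by oriented semiarcs, together with finitely many crossingless circles (each of them also counted as a semiarc). Planarity is not required (so virtual link diagrams are allowed); an oriented link is a class of planar diagrams under renaming and oriented Reidemeister moves through planar diagrams. Draw each crossing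 with both strands pointing down. An $X$-coloring assigns elements of $X$ to the semiarcs so that at each crossing, if the ends on the left carry $x$ on the under-strand and $y$ on the over-strand, then the ends on the right carry $x\,\underline{\triangleright}\,y$ on the under-strand and $y\,\overline{\triangleright}\,x$ on the over-strand. **State sum.** A Kauffman state chooses the oriented or the unoriented smoothing at each crossing. With $x,y$ as above, the oriented smoothing has coefficient $A_{x,y}$ at a positive and $A_{x,y}^{-1}$ at a negative crossing, and the unoriented one has $B_{x,y}$, respectively $B_{x,y}^{-1}$. For an $X$-coloring $f$ of a diagram $D$ with $p$ positive and $n$ negative crossings, $$\beta(f)=w^{\,n-p}\sum_{S}\Big(\prod_{c}\text{coefficient of }S\text{ at }c\Big)\,\delta^{k(S)},$$ where $S$ runs over all Kauffman states, $c$ over all crossings, and $k(S)$ is the number of circles of $S$. Put $\Phi_X^{\beta,M}(D)=\{\beta(f)\}_f$ (a multiset) and $\Phi_X^{\beta}(D)=\sum_f u^{\beta(f)}$ (a formal sum with integer coefficients and exponents in $R$), where $f$ runs over all $X$-colorings of $D$. **Theorem.** Let $X$ be a finite biquandle, $R$ a commutative ring with identity and $\beta$ an $X$-bracket over $R$. 1.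 Let $D$ and $D'$ differ by a renaming or by one oriented Reidemeister move (any of the four moves of type I, four of type II and eight of type III). Every $X$-coloring of either diagram agrees, on the semiarcs outside the disc of the move, with exactly one $X$-coloring of the other; and if $f$ and $f'$ are $X$-colorings of $D$ and $D'$ that so agree, then $\beta(f)=\beta(f')$. 2. If $D$ and $D'$ are related by a finite sequence of renamings and oriented Reidemeister moves, then $\Phi_X^{\beta,M}(D)=\Phi_X^{\beta,M}(D')$ and $\Phi_X^{\beta}(D)=\Phi_X^{\beta}(D')$. 3. In particular, $\Phi_X^{\beta,M}$ and $\Phi_X^{\beta}$ are well-defined invariants of oriented links. -/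

import Mathlib

/-- A biquandle: `underOp x y` is "`x` crosses under `y`", `overOp x y` is "`x` crosses over `y`". -/
class Biquandle (X : Type*) where
  underOp : X → X → X
  overOp : X → X → X
  under_self : ∀ x, underOp x x = overOp x x
  over_bijective : ∀ y, Function.Bijective fun x => overOp x y
  under_bijective : ∀ y, Function.Bijective fun x => underOp x y
  side_bijective : Function.Bijective fun p : X × X => (overOp p.2 p.1, underOp p.1 p.2)
  exchange_under_under : ∀ x y z,
    underOp (underOp x y) (underOp z y) = underOp (underOp x z) (overOp y z)
  exchange_under_over : ∀ x y z,
    overOp (underOp x y) (underOp z y) = underOp (overOp x z) (overOp y z)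
  exchange_over_over : ∀ x y z,
    overOp (overOp x y) (overOp z y) = overOp (overOp x z) (underOp y z)

open Biquandle in
/-- A biquandle bracket on `X` with values in `R` (an `X`-bracket). -/
structure BiquandleBracket (X : Type*) [Biquandle X] (R : Type*) [CommRing R] where
  A : X → X → Rˣ
  B : X → X → Rˣ
  δ : R
  w : Rˣ
  kink_pos : ∀ x, δ * (A x x : R) + (B x x : R) = (w : R)
  kink_neg : ∀ x, δ * ((A x x)⁻¹ : Rˣ) + ((B x x)⁻¹ : Rˣ) = ((w⁻¹ : Rˣ) : R)
  loop : ∀ x y, δ = - ((A x y : R) * ((B x y)⁻¹ : Rˣ)) - ((A x y)⁻¹ : Rˣ) * (B x y : R)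
  three_AAA : ∀ x y z,
    A x y * A y z * A (underOp x y) (overOp z y)
      = A x z * A (overOp y x) (overOp z x) * A (underOp x z) (underOp y z)
  three_ABB : ∀ x y z,
    A x y * B y z * B (underOp x y) (overOp z y)
      = B x z * B (overOp y x) (overOp z x) * A (underOp x z) (underOp y z)
  three_BAB : ∀ x y z,
    B x y * A y z * B (underOp x y) (overOp z y)
      = B x z * A (overOp y x) (overOp z x) * B (underOp x z) (underOp y z)
  three_AAB : ∀ x y z,
    (A x y * A y z * B (underOp x y) (overOp z y) : R)
      = A x z * B (overOp y x) (overOp z x) * A (underOp x z) (underOp y z)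
        + A x z * A (overOp y x) (overOp z x) * B (underOp x z) (underOp y z)
        + δ * A x z * B (overOp y x) (overOp z x) * B (underOp x z) (underOp y z)
        + B x z * B (overOp y x) (overOp z x) * B (underOp x z) (underOp y z)
  three_BAA : ∀ x y z,
    (B x y * A y z * A (underOp x y) (overOp z y)
        + A x y * B y z * A (underOp x y) (overOp z y)
        + δ * B x y * B y z * A (underOp x y) (overOp z y)
        + B x y * B y z * B (underOp x y) (overOp z y) : R)
      = B x z * A (overOp y x) (overOp z x) * A (underOp x z) (underOp y z)

/-- The two strands through a crossing: the over-strand and the under-strand. -/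
inductive Strand where
  | upper
  | lower

/-- The other strand through the same crossing. -/
def Strand.other : Strand → Strand
  | .upper => .lower
  | .lower => .upper

/-- An oriented link diagram, given combinatorially by its signed crossings and its semiarcs.
`inn (c, s)` and `out (c, s)` are the semiarcs by which the strand `s` enters and leaves the
crossing `c`. A semiarc that meets crossings runs from exactly one crossing to exactly one
crossing; the semiarcs outside the common range of `inn` and `out` are the circle components
without crossings. The diagram need not be planar, so virtual link diagrams are included; the
classical ones are singled out by `LinkDiagram.IsPlanar`. -/
structure LinkDiagram where
  Crossing : Type
  Arc : Type
  [fintypeCrossing : Fintype Crossing]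
  [fintypeArc : Fintype Arc]
  sign : Crossing → ℤˣ
  inn : Crossing × Strand → Arc
  out : Crossing × Strand → Arc
  inn_injective : Function.Injective inn
  out_injective : Function.Injective out
  range_inn_eq_range_out : Set.range inn = Set.range out

namespace LinkDiagram

attribute [instance] fintypeCrossing fintypeArc

/-! Draw a crossing with both strands pointing down. At a positive crossing the under-strand runs
from top left to bottom right and the over-strand from top right to bottom left; at a negative
crossing it is the other way round. The four functions below give the end of each strand at the
left, respectively at the right, of the crossing. -/

/-- The semiarc of the under-strand on the left side of the crossing. -/
def leftUnder (D : LinkDiagram) (c : D.Crossing) : D.Arc :=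
  if D.sign c = 1 then D.inn (c, .lower) else D.out (c, .lower)

/-- The semiarc of the over-strand on the left side of the crossing. -/
def leftOver (D : LinkDiagram) (c : D.Crossing) : D.Arc :=
  if D.sign c = 1 then D.out (c, .upper) else D.inn (c, .upper)

/-- The semiarc of the under-strand on the right side of the crossing. -/
def rightUnder (D : LinkDiagram) (c : D.Crossing) : D.Arc :=
  if D.sign c = 1 then D.out (c, .lower) else D.inn (c, .lower)

/-- The semiarc of the over-strand on the right side of the crossing. -/
def rightOver (D : LinkDiagram) (c : D.Crossing) : D.Arc :=
  if D.sign c = 1 then D.inn (c, .upper) else D.out (c, .upper)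

/-- An `X`-coloring of the semiarcs: if the left side of a crossing carries `x` on the under-strand
and `y` on the over-strand, its right side carries `underOp x y` and `overOp y x`. -/
def Coloring (D : LinkDiagram) (X : Type*) [Biquandle X] : Type _ :=
  {f : D.Arc → X // ∀ c,
    f (D.rightUnder c) = Biquandle.underOp (f (D.leftUnder c)) (f (D.leftOver c)) ∧
    f (D.rightOver c) = Biquandle.overOp (f (D.leftOver c)) (f (D.leftUnder c))}

noncomputable instance (D : LinkDiagram) (X : Type*) [Finite X] [Biquandle X] :
    Fintype (D.Coloring X) :=
  haveI : Finite (D.Coloring X) := by unfold Coloring; infer_instance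
  Fintype.ofFinite _

/-- The two ways to smooth a crossing: the oriented smoothing joins the incoming end of each strand
to the outgoing end of the other, the unoriented one joins the two incoming ends and the two
outgoing ends. -/
inductive Smoothing where
  | oriented
  | unoriented
  deriving DecidableEq

instance : Fintype Smoothing :=
  ⟨{.oriented, .unoriented}, fun t => by cases t <;> simp⟩

/-- The smoothing `t` at the crossing `c` joins the ends of `a` and `b` there. -/
def SmoothingJoins (D : LinkDiagram) (c : D.Crossing) : Smoothing → D.Arc → D.Arc → Prop
  | .oriented, a, b =>
      (a = D.inn (c, .upper) ∧ b = D.out (c, .lower)) ∨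
      (a = D.inn (c, .lower) ∧ b = D.out (c, .upper))
  | .unoriented, a, b =>
      (a = D.inn (c, .upper) ∧ b = D.inn (c, .lower)) ∨
      (a = D.out (c, .upper) ∧ b = D.out (c, .lower))

/-- A Kauffman state: a choice of smoothing at every crossing. -/
abbrev State (D : LinkDiagram) : Type := D.Crossing → Smoothing

/-- The number of circles of a Kauffman state, i.e. of classes of semiarcs under the equivalence
relation generated by being joined at a smoothed crossing. -/
noncomputable def circles (D : LinkDiagram) (s : D.State) : ℕ :=
  Nat.card (Quot fun a b => ∃ c, D.SmoothingJoins c (s c) a b)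

/-- The number of negative crossings minus the number of positive crossings. -/
def negWrithe (D : LinkDiagram) : ℤ :=
  ((Finset.univ.filter fun c => D.sign c = -1).card : ℤ)
    - (Finset.univ.filter fun c => D.sign c = 1).card

section StateSum

variable {X : Type*} [Biquandle X] {R : Type*} [CommRing R]

/-- The coefficient of a smoothing at a crossing whose left side is colored `x` (under) and
`y` (over): `A x y` or `B x y` at a positive crossing, the inverse at a negative one. -/
def smoothingCoeff (D : LinkDiagram) (β : BiquandleBracket X R) (f : D.Coloring X)
    (c : D.Crossing) : Smoothing → Rˣ
  | .oriented => β.A (f.1 (D.leftUnder c)) (f.1 (D.leftOver c)) ^ (D.sign c : ℤ)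
  | .unoriented => β.B (f.1 (D.leftUnder c)) (f.1 (D.leftOver c)) ^ (D.sign c : ℤ)

open Classical in
/-- The state-sum value `β(f)` of an `X`-coloring `f`. -/
noncomputable def bracketValue (D : LinkDiagram) (β : BiquandleBracket X R) (f : D.Coloring X) :
    R :=
  ((β.w ^ D.negWrithe : Rˣ) : R) *
    ∑ s : D.State, (∏ c, (D.smoothingCoeff β f c (s c) : R)) * β.δ ^ D.circles s

/-- The biquandle bracket multiset: the values `β(f)` over all `X`-colorings `f`. -/
noncomputable def bracketMultiset [Finite X] (D : LinkDiagram) (β : BiquandleBracket X R) :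
    Multiset R :=
  (Finset.univ : Finset (D.Coloring X)).val.map (D.bracketValue β)

/-- The biquandle bracket polynomial `∑ u ^ β(f)`, with integer coefficients and exponents in `R`;
the formal power `u ^ r` is `AddMonoidAlgebra.single r 1`. -/
noncomputable def bracketPolynomial [Finite X] (D : LinkDiagram) (β : BiquandleBracket X R) :
    AddMonoidAlgebra ℤ R :=
  ∑ f : D.Coloring X, AddMonoidAlgebra.single (D.bracketValue β f) (1 : ℤ)

end StateSum

/-! Reidemeister moves. -/

/-- `D` arises from `D'` by deleting the crossings in `S` and letting each strand through a deleted
crossing run on: `κ` is the inclusion of the remaining crossings, and `π` sends each semiarc of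
`D'` to the semiarc of `D` that it becomes part of. -/
structure IsErasure (D D' : LinkDiagram) (S : Set D'.Crossing)
    (κ : D.Crossing → D'.Crossing) (π : D'.Arc → D.Arc) : Prop where
  injective : Function.Injective κ
  range_eq : Set.range κ = Sᶜ
  surjective : Function.Surjective π
  eq_iff : ∀ a b, π a = π b ↔
    Relation.EqvGen (fun a b => ∃ c ∈ S, ∃ t, a = D'.inn (c, t) ∧ b = D'.out (c, t)) a b
  sign_eq : ∀ c, D.sign c = D'.sign (κ c)
  inn_eq : ∀ c t, D.inn (c, t) = π (D'.inn (κ c, t))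
  out_eq : ∀ c t, D.out (c, t) = π (D'.out (κ c, t))

/-- `D'` is `D`, up to the renamings `κ` of crossings and `ι` of semiarcs, except that the passage
`p` of a strand through a crossing now takes the place that the passage `τ p` had in `D`. -/
structure IsRewiring (D D' : LinkDiagram) (τ : Equiv.Perm (D.Crossing × Strand))
    (κ : D.Crossing ≃ D'.Crossing) (ι : D.Arc ≃ D'.Arc) : Prop where
  sign_eq : ∀ c, D'.sign (κ c) = D.sign c
  inn_eq : ∀ p : D.Crossing × Strand, D'.inn (κ p.1, p.2) = ι (D.inn (τ p))
  out_eq : ∀ p : D.Crossing × Strand, D'.out (κ p.1, p.2) = ι (D.out (τ p))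

/-- The passages `p` and `q` are joined by the single semiarc `a`, traversed from `p` to `q` if
`ε = 1` and from `q` to `p` if `ε = -1`. -/
def Consecutive (D : LinkDiagram) (ε : ℤˣ) (p q : D.Crossing × Strand) (a : D.Arc) : Prop :=
  if ε = 1 then D.out p = a ∧ D.inn q = a else D.out q = a ∧ D.inn p = a

open Classical in
/-- The exchange of places that a type III move makes on its three strands: `tm`, `tb`, `mb` are
the crossings of top and middle, top and bottom, middle and bottom strand. -/
noncomputable def triangleSwap (D : LinkDiagram) (tm tb mb : D.Crossing) :
    Equiv.Perm (D.Crossing × Strand) :=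
  Equiv.swap (tm, .upper) (tb, .upper) * Equiv.swap (tm, .lower) (mb, .upper) *
    Equiv.swap (tb, .lower) (mb, .lower)

/-- `ReidemeisterMove D D' r`: the diagrams `D` and `D'` differ by one oriented Reidemeister move
(or by a renaming), and `r a a'` says that the semiarcs `a` of `D` and `a'` of `D'` agree outside
the disc where the move takes place. The moves of type I and II are written in the direction that
creates crossings.

* Type I: the curl is the semiarc joining one passage of the crossing to the other. The sign and
  the strand that is passed first are arbitrary, which makes four moves.
* Type II: two crossings of opposite signs, one strand passing over at both. The strands pass the
  crossings in the same order (direct) or in opposite orders (reverse); four moves in all.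
* Type III: three strands in general position bound a triangle with sides `e₁`, `e₂`, `e₃`. The
  three signs are arbitrary, which makes eight moves, and `η` tells on which side of the crossing of
  two of the strands the third one passes. The signs and `η` determine the order in which each
  strand meets the two others, and the move reverses these three orders. -/
inductive ReidemeisterMove : (D D' : LinkDiagram) → (D.Arc → D'.Arc → Prop) → Prop
  | rename {D D' : LinkDiagram} {κ : D.Crossing ≃ D'.Crossing} {ι : D.Arc ≃ D'.Arc}
      (h : IsRewiring D D' 1 κ ι) :
      ReidemeisterMove D D' fun a a' => a' = ι a
  | typeI {D D' : LinkDiagram} {κ : D.Crossing → D'.Crossing} {π : D'.Arc → D.Arc}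
      (c : D'.Crossing) (t : Strand) (curl : D'.out (c, t) = D'.inn (c, t.other))
      (h : IsErasure D D' {c} κ π) :
      ReidemeisterMove D D' fun a a' => a' ≠ D'.out (c, t) ∧ a = π a'
  | directTypeII {D D' : LinkDiagram} {κ : D.Crossing → D'.Crossing} {π : D'.Arc → D.Arc}
      (c₁ c₂ : D'.Crossing) (sign : D'.sign c₂ = - D'.sign c₁)
      (overPass : D'.out (c₁, .upper) = D'.inn (c₂, .upper))
      (underPass : D'.out (c₁, .lower) = D'.inn (c₂, .lower))
      (h : IsErasure D D' {c₁, c₂} κ π) :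
      ReidemeisterMove D D' fun a a' =>
        a' ≠ D'.out (c₁, .upper) ∧ a' ≠ D'.out (c₁, .lower) ∧ a = π a'
  | reverseTypeII {D D' : LinkDiagram} {κ : D.Crossing → D'.Crossing} {π : D'.Arc → D.Arc}
      (c₁ c₂ : D'.Crossing) (sign : D'.sign c₂ = - D'.sign c₁)
      (overPass : D'.out (c₁, .upper) = D'.inn (c₂, .upper))
      (underPass : D'.out (c₂, .lower) = D'.inn (c₁, .lower))
      (h : IsErasure D D' {c₁, c₂} κ π) :
      ReidemeisterMove D D' fun a a' =>
        a' ≠ D'.out (c₁, .upper) ∧ a' ≠ D'.out (c₂, .lower) ∧ a = π a'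
  | typeIII {D D' : LinkDiagram} {κ : D.Crossing ≃ D'.Crossing} {ι : D.Arc ≃ D'.Arc}
      (tm tb mb : D.Crossing) (tm_ne_tb : tm ≠ tb) (tm_ne_mb : tm ≠ mb) (tb_ne_mb : tb ≠ mb)
      (η : ℤˣ) (e₁ e₂ e₃ : D.Arc)
      (top : D.Consecutive (η * D.sign tb) (tm, .upper) (tb, .upper) e₁)
      (middle : D.Consecutive (η * D.sign mb) (tm, .lower) (mb, .upper) e₂)
      (bottom : D.Consecutive (η * D.sign tm * D.sign tb * D.sign mb)
        (tb, .lower) (mb, .lower) e₃)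
      (h : IsRewiring D D' (D.triangleSwap tm tb mb) κ ι) :
      ReidemeisterMove D D' fun a a' => a ≠ e₁ ∧ a ≠ e₂ ∧ a ≠ e₃ ∧ a' = ι a

/-- Two colorings agree on the semiarcs that correspond under `r`. For a move `r` this says that
the colored diagrams differ by an `X`-colored Reidemeister move. -/
def Coloring.Agree {X : Type*} [Biquandle X] {D D' : LinkDiagram} (r : D.Arc → D'.Arc → Prop)
    (f : D.Coloring X) (f' : D'.Coloring X) : Prop :=
  ∀ a a', r a a' → f.1 a = f'.1 a'

/-- The equivalence relation on diagrams generated by the oriented Reidemeister moves. -/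
def ReidemeisterEquiv : LinkDiagram → LinkDiagram → Prop :=
  Relation.EqvGen fun D D' => ∃ r, ReidemeisterMove D D' r

/-! Planarity. Draw a crossing with both strands pointing down, as above. It has four corners: the
left and the right one, the one between the incoming ends and the one between the outgoing ends.
A face is a class of corners joined along the sides of semiarcs, and the diagram is planar if
Euler's formula gives genus zero to each of its connected components. -/

/-- The four corners at a crossing. -/
inductive Corner where
  | left
  | right
  | incoming
  | outgoing

open Classical in
/-- The strand that comes in from the left. -/
noncomputable def leftStrand (D : LinkDiagram) (c : D.Crossing) : Strand :=
  if D.sign c = 1 then .lower else .upper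

open Classical in
/-- The corners at the left and at the right of the incoming end of a passage, as seen on the
page. -/
noncomputable def innCorners (D : LinkDiagram) (p : D.Crossing × Strand) : Corner × Corner :=
  if p.2 = D.leftStrand p.1 then (.left, .incoming) else (.incoming, .right)

open Classical in
/-- The corners at the left and at the right of the outgoing end of a passage, as seen on the
page. -/
noncomputable def outCorners (D : LinkDiagram) (p : D.Crossing × Strand) : Corner × Corner :=
  if p.2 = D.leftStrand p.1 then (.outgoing, .right) else (.left, .outgoing)

/-- Two corners joined along a side of the semiarc from the passage `p` to the passage `q`. -/
def CornersJoined (D : LinkDiagram) (x y : D.Crossing × Corner) : Prop :=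
  ∃ p q, D.out p = D.inn q ∧
    ((x = (p.1, (D.outCorners p).1) ∧ y = (q.1, (D.innCorners q).1)) ∨
     (x = (p.1, (D.outCorners p).2) ∧ y = (q.1, (D.innCorners q).2)))

/-- The diagram can be drawn in the plane with no crossings other than its own. Circles without
crossings play no role here. -/
def IsPlanar (D : LinkDiagram) : Prop :=
  Nat.card (Quot D.CornersJoined) =
    Nat.card D.Crossing + 2 * Nat.card (Quot fun c c' : D.Crossing =>
      ∃ t t', D.out (c, t) = D.inn (c', t'))

end LinkDiagram

/-- Oriented links: planar oriented link diagrams up to oriented Reidemeister moves through planar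
diagrams. -/
def OrientedLink : Type 1 :=
  Quot fun D D' : {D : LinkDiagram // D.IsPlanar} => ∃ r, LinkDiagram.ReidemeisterMove D.1 D'.1 r

/-- The oriented link of a planar diagram. -/
def OrientedLink.ofDiagram (D : {D : LinkDiagram // D.IsPlanar}) : OrientedLink := Quot.mk _ D

/-!
The state sum of a diagram is a sum over states of a product of coefficients times a power of `δ`,
whose exponent is the number of classes of an equivalence relation on the semiarcs: the join of the
pairs of ends joined at the smoothed crossings. Hence a state sum can be evaluated in two steps
(`stateSum_eq_sum`): for each choice of smoothings outside the disc of a move, sum over the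
smoothings inside. In the inner sums the semiarcs inside the disc are isolated classes of the outer
relation, so all that matters is which outer ends each inner state joins and how many circles it
closes up. The three inner sums are `stateSum_kink`, `stateSum_bigon` and `stateSum_triangle`; no
planarity is needed.

Orientations are dealt with by naming the ends of a strand at a crossing by its left and right side
(`strandEnd`). In these terms neither the coloring condition (`IsFace`) nor the joins made by the
smoothing `Smoothing.joining a b` depend on the sign of the crossing, and the moves of each type
have one description: in type I both strands share an end on the same side, in type II the two
crossings share ends on equal sides of both strands, and in type III the triangle lies on the sides
`σt`, `σm`, `σb` of the three strands, which the move reverses (`IsTriangleMove`).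

The colors of three strands before and after a type III move are those of the edges of a cube with
the six crossings as faces (`IsCube`). The exchange laws extend the colors at one vertex of the cube
to a coloring; as `X` is finite and a cube is determined by the colors at any vertex, the colors at
every vertex extend (`exists_isCube`). This gives the correspondence of colorings, for all
orientations at once. Finiteness is used in the same way for kinks (`exists_isFace_self`).

The bracket equations are given for one orientation of the three strands. Other orientations
replace coefficients by their inverses and exchange the two faces on opposite sides of the cube. The
equations imply that the ratios `B / A` of the coefficients on opposite faces differ by a common
factor `lam` with `lam ^ 2 = 1` and `δ * lam = δ`, that each ratio is a root of `u ^ 2 + δ * u + 1`,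
and one relation between three of them (`TriangleRatios`). These relations are preserved by
multiplying a ratio by `lam` and by inverting all three, so that the identities needed for the
state sums hold for all orientations (`TriangleWeights.triangleIdentity`).
-/

/-! ### Counting classes of equivalence relations -/

section ClassCount

variable {V W : Type*}

/-- The smallest equivalence relation that identifies `a` and `b`. -/
def joinPair (a b : V) : Setoid V :=
  Relation.EqvGen.setoid fun x y => x = a ∧ y = b

theorem joinPair_le {a b : V} {S : Setoid V} : joinPair a b ≤ S ↔ S a b := by
  constructor
  · exact fun h => h (Relation.EqvGen.rel _ _ ⟨rfl, rfl⟩)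
  · intro h
    refine Setoid.eqvGen_le ?_
    rintro _ _ ⟨rfl, rfl⟩
    exact h

/-- An equivalence relation contains a pair iff the two classes are equal; in this form
inclusions between joins of pairs are matters of equational reasoning. -/
theorem joinPair_le_iff_mk_eq {a b : V} {S : Setoid V} :
    joinPair a b ≤ S ↔ Quotient.mk S a = Quotient.mk S b := by
  rw [joinPair_le, Quotient.eq]

theorem joinPair_self (a : V) : joinPair a a = ⊥ :=
  le_bot_iff.1 (joinPair_le.2 rfl)

theorem joinPair_comm (a b : V) : joinPair a b = joinPair b a :=
  le_antisymm (joinPair_le.2 (Setoid.symm' _ (joinPair_le.1 le_rfl)))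
    (joinPair_le.2 (Setoid.symm' _ (joinPair_le.1 le_rfl)))

/-- The number of classes of an equivalence relation. -/
noncomputable def classCount (S : Setoid V) : ℕ := Nat.card (Quotient S)

/-- Joining two different classes lowers the number of classes by one. -/
theorem classCount_sup_joinPair [Finite V] {S : Setoid V} {a b : V} (h : ¬ S a b) :
    classCount (S ⊔ joinPair a b) + 1 = classCount S := by
  classical
  -- The join is the kernel of the map that sends the class of `b` to that of `a`.
  let g : V → Quotient S := fun x => if Quotient.mk S x = Quotient.mk S b then Quotient.mk S a
    else Quotient.mk S x
  have hab : Quotient.mk S a ≠ Quotient.mk S b := fun e => h (Quotient.eq.1 e)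
  have hg : S ⊔ joinPair a b = Setoid.ker g := by
    apply le_antisymm
    · refine sup_le (fun {x y} hxy => ?_) (joinPair_le.2 ?_)
      · have : Quotient.mk S x = Quotient.mk S y := Quotient.eq.2 hxy
        simp only [Setoid.ker_def, g, this]
      · simp [Setoid.ker_def, g]
    · intro x y hxy
      have h₁ : ∀ {u v : V}, Quotient.mk S u = Quotient.mk S v → (S ⊔ joinPair a b) u v :=
        fun e => (le_sup_left : S ≤ S ⊔ joinPair a b) (Quotient.eq.1 e)
      have h₂ : (S ⊔ joinPair a b) a b := joinPair_le.1 le_sup_right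
      rw [Setoid.ker_def] at hxy
      simp only [g] at hxy
      split_ifs at hxy with hx hy hy
      · exact h₁ (hx.trans hy.symm)
      · exact Setoid.trans' _ (h₁ hx) (Setoid.trans' _ (Setoid.symm' _ h₂) (h₁ hxy))
      · exact Setoid.trans' _ (h₁ hxy) (Setoid.trans' _ h₂ (h₁ hy.symm))
      · exact h₁ hxy
  have hr : Set.range g = {Quotient.mk S b}ᶜ := by
    ext q
    constructor
    · rintro ⟨x, rfl⟩
      simp only [g, Set.mem_compl_iff, Set.mem_singleton_iff]
      split_ifs with hx
      · exact hab
      · exact hx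
    · intro hq
      obtain ⟨x, rfl⟩ := Quotient.exists_rep q
      exact ⟨x, if_neg hq⟩
  have := Set.ncard_add_ncard_compl ({Quotient.mk S b} : Set (Quotient S))
  rw [Set.ncard_singleton, ← hr] at this
  rw [hg, classCount, classCount, Nat.card_congr (Setoid.quotientKerEquivRange g),
    Nat.card_coe_set_eq]
  omega

/-- The element `e` is alone in its class. -/
def Isolated (S : Setoid V) (e : V) : Prop := S ≤ Setoid.ker (· = e)

theorem Isolated.not_rel {S : Setoid V} {e a : V} (h : Isolated S e) (ha : a ≠ e) : ¬ S e a :=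
  fun hea => ha ((h hea).mp rfl)

theorem isolated_joinPair {e a b : V} (ha : a ≠ e) (hb : b ≠ e) : Isolated (joinPair a b) e :=
  joinPair_le.2 (by simp [Setoid.ker_def, ha, hb])

theorem Isolated.sup {S T : Setoid V} {e : V} (hS : Isolated S e) (hT : Isolated T e) :
    Isolated (S ⊔ T) e :=
  sup_le hS hT

theorem isolated_iSup {ι : Type*} {S : ι → Setoid V} {e : V} (h : ∀ i, Isolated (S i) e) :
    Isolated (⨆ i, S i) e :=
  iSup_le h

/-- Attaching an isolated element to another class lowers the number of classes by one. -/
theorem Isolated.classCount_sup_joinPair [Finite V] {S : Setoid V} {e a : V} (h : Isolated S e)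
    (ha : a ≠ e) : classCount (S ⊔ joinPair e a) + 1 = classCount S :=
  _root_.classCount_sup_joinPair (h.not_rel ha)

theorem Setoid.map_le_iff {f : V → W} {S : Setoid V} {T : Setoid W} :
    S.map f ≤ T ↔ S ≤ T.comap f :=
  ⟨fun h => Setoid.le_comap_map.trans fun {_ _} hxy => h hxy, fun h => Setoid.eqvGen_le (by
    rintro _ _ ⟨a, b, hab, rfl, rfl⟩
    exact h hab)⟩

theorem Setoid.gc_map_comap (f : V → W) :
    GaloisConnection (fun S : Setoid V => S.map f) (Setoid.comap f) :=
  fun _ _ => Setoid.map_le_iff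

theorem Setoid.map_sup (f : V → W) (S T : Setoid V) : (S ⊔ T).map f = S.map f ⊔ T.map f :=
  (Setoid.gc_map_comap f).l_sup

theorem Setoid.map_iSup {ι : Type*} (f : V → W) (S : ι → Setoid V) :
    (⨆ i, S i).map f = ⨆ i, (S i).map f :=
  (Setoid.gc_map_comap f).l_iSup

theorem Setoid.map_joinPair (f : V → W) (a b : V) :
    (joinPair a b).map f = joinPair (f a) (f b) :=
  eq_of_forall_ge_iff fun T => by
    rw [Setoid.map_le_iff, joinPair_le, joinPair_le, Setoid.comap_rel]

theorem classCount_comap {f : V → W} (hf : Function.Surjective f) (T : Setoid W) :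
    classCount (T.comap f) = classCount T := by
  have h := Nat.card_congr (Setoid.comapQuotientEquiv f T)
  rw [(Quotient.mk''_surjective.comp hf).range_eq] at h
  rw [classCount, h, Nat.card_coe_set_eq, Set.ncard_univ, classCount]

/-- Along a surjection the classes of the image are those of the join with the kernel. -/
theorem classCount_map {f : V → W} (hf : Function.Surjective f) (S : Setoid V) :
    classCount (S.map f) = classCount (S ⊔ Setoid.ker f) := by
  have hk : (Setoid.ker f).map f ≤ S.map f :=
    Setoid.map_le_iff.2 fun {x y} hxy => by
      rw [Setoid.comap_rel, Setoid.ker_def.1 hxy]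
  rw [← classCount_comap hf, ← Setoid.comap_map_of_ker_le f (S ⊔ Setoid.ker f) le_sup_right,
    Setoid.map_sup, sup_eq_left.2 hk]

theorem classCount_map_equiv (e : V ≃ W) (S : Setoid V) :
    classCount (S.map e) = classCount S := by
  rw [classCount_map e.surjective, Setoid.ker_eq_bot_iff.2 e.injective, sup_bot_eq]

end ClassCount

namespace LinkDiagram

/-! ### Ends of strands and smoothings -/

theorem units_neg_ne_self (a : ℤˣ) : -a ≠ a := by
  rcases Int.units_eq_one_or a with rfl | rfl <;> decide

theorem units_eq_or_eq_neg (a b : ℤˣ) : a = b ∨ a = -b := by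
  rcases Int.units_eq_one_or a with rfl | rfl <;> rcases Int.units_eq_one_or b with rfl | rfl <;>
    decide

section Ends

variable (D : LinkDiagram)

/-- The side of a crossing, left (`1`) or right (`-1`), from which a strand comes in. -/
def innSide : D.Crossing × Strand → ℤˣ
  | (c, .lower) => D.sign c
  | (c, .upper) => -D.sign c

/-- The semiarc of a strand at one side of a crossing, left if `a = 1` and right if `a = -1`.
Whatever the orientation of the strand itself, its left end lies on the right-hand side of the
other strand, and its right end on the left-hand side. -/
def strandEnd (p : D.Crossing × Strand) (a : ℤˣ) : D.Arc :=
  if a = D.innSide p then D.inn p else D.out p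

/-- The semiarc of the under-strand at the side `a` of a crossing. -/
abbrev underEnd (c : D.Crossing) (a : ℤˣ) : D.Arc := D.strandEnd (c, .lower) a

/-- The semiarc of the over-strand at the side `a` of a crossing. -/
abbrev overEnd (c : D.Crossing) (a : ℤˣ) : D.Arc := D.strandEnd (c, .upper) a

theorem strandEnd_innSide (p : D.Crossing × Strand) : D.strandEnd p (D.innSide p) = D.inn p :=
  if_pos rfl

theorem strandEnd_neg_innSide (p : D.Crossing × Strand) :
    D.strandEnd p (-D.innSide p) = D.out p :=
  if_neg (units_neg_ne_self _)

theorem underEnd_sign (c : D.Crossing) : D.underEnd c (D.sign c) = D.inn (c, .lower) :=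
  D.strandEnd_innSide (c, .lower)

theorem underEnd_neg_sign (c : D.Crossing) : D.underEnd c (-D.sign c) = D.out (c, .lower) :=
  D.strandEnd_neg_innSide (c, .lower)

theorem overEnd_neg_sign (c : D.Crossing) : D.overEnd c (-D.sign c) = D.inn (c, .upper) :=
  D.strandEnd_innSide (c, .upper)

theorem overEnd_sign (c : D.Crossing) : D.overEnd c (D.sign c) = D.out (c, .upper) := by
  simpa [innSide] using D.strandEnd_neg_innSide (c, .upper)

theorem leftUnder_eq (c : D.Crossing) : D.leftUnder c = D.underEnd c 1 := by
  rcases Int.units_eq_one_or (D.sign c) with h | h <;> simp [leftUnder, strandEnd, innSide, h]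

theorem leftOver_eq (c : D.Crossing) : D.leftOver c = D.overEnd c 1 := by
  rcases Int.units_eq_one_or (D.sign c) with h | h <;> simp [leftOver, strandEnd, innSide, h]

theorem rightUnder_eq (c : D.Crossing) : D.rightUnder c = D.underEnd c (-1) := by
  rcases Int.units_eq_one_or (D.sign c) with h | h <;> simp [rightUnder, strandEnd, innSide, h]

theorem rightOver_eq (c : D.Crossing) : D.rightOver c = D.overEnd c (-1) := by
  rcases Int.units_eq_one_or (D.sign c) with h | h <;> simp [rightOver, strandEnd, innSide, h]

variable {D}

/-- A semiarc has at most two ends. -/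
theorem eq_or_eq_of_strandEnd_eq {p q r : D.Crossing × Strand} {a b d : ℤˣ}
    (h : D.strandEnd p a = D.strandEnd q b) (hne : p ≠ q)
    (h' : D.strandEnd r d = D.strandEnd p a) : (r = p ∧ d = a) ∨ (r = q ∧ d = b) := by
  have out_side : ∀ {p : D.Crossing × Strand} {a : ℤˣ}, a ≠ D.innSide p → a = -D.innSide p :=
    fun {p a} ha => (units_eq_or_eq_neg a (D.innSide p)).resolve_left ha
  have hi := @D.inn_injective
  have ho := @D.out_injective
  have h'' := h'.trans h
  unfold strandEnd at h h' h''
  -- Of the ends `p` and `q`, one is incoming and the other outgoing.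
  by_cases ha : a = D.innSide p <;> by_cases hb : b = D.innSide q
  · rw [if_pos ha, if_pos hb] at h
    exact absurd (hi h) hne
  · by_cases hd : d = D.innSide r
    · rw [if_pos hd, if_pos ha] at h'
      obtain rfl := hi h'
      exact Or.inl ⟨rfl, hd.trans ha.symm⟩
    · rw [if_neg hd, if_neg hb] at h''
      obtain rfl := ho h''
      exact Or.inr ⟨rfl, (out_side hd).trans (out_side hb).symm⟩
  · by_cases hd : d = D.innSide r
    · rw [if_pos hd, if_pos hb] at h''
      obtain rfl := hi h''
      exact Or.inr ⟨rfl, hd.trans hb.symm⟩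
    · rw [if_neg hd, if_neg ha] at h'
      obtain rfl := ho h'
      exact Or.inl ⟨rfl, (out_side hd).trans (out_side ha).symm⟩
  · rw [if_neg ha, if_neg hb] at h
    exact absurd (ho h) hne

/-- The joins made by a smoothing at a crossing, as an equivalence relation. -/
def smoothingSetoid (D : LinkDiagram) (c : D.Crossing) (t : Smoothing) : Setoid D.Arc :=
  Relation.EqvGen.setoid (D.SmoothingJoins c t)

/-- The smoothing that joins the end of the under-strand at the side `a` to the end of the
over-strand at the side `b`. -/
def Smoothing.joining (a b : ℤˣ) : Smoothing := if a = b then .oriented else .unoriented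

/-- In terms of left and right ends the smoothings do not depend on the sign of the crossing. -/
theorem smoothingSetoid_joining (c : D.Crossing) (a b : ℤˣ) :
    D.smoothingSetoid c (Smoothing.joining a b) =
      joinPair (D.underEnd c a) (D.overEnd c b) ⊔ joinPair (D.underEnd c (-a)) (D.overEnd c (-b)) :=
    by
  have h₁ : ∀ {p q r s : D.Arc},
      Relation.EqvGen.setoid (fun x y => (x = p ∧ y = q) ∨ (x = r ∧ y = s)) =
        joinPair p q ⊔ joinPair r s := by
    intro p q r s
    apply le_antisymm
    · apply Setoid.eqvGen_le
      rintro x y (⟨rfl, rfl⟩ | ⟨rfl, rfl⟩)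
      · exact joinPair_le.1 le_sup_left
      · exact joinPair_le.1 le_sup_right
    · exact sup_le (joinPair_le.2 (.rel _ _ (Or.inl ⟨rfl, rfl⟩)))
        (joinPair_le.2 (.rel _ _ (Or.inr ⟨rfl, rfl⟩)))
  have ho : D.smoothingSetoid c .oriented = joinPair (D.inn (c, .upper)) (D.out (c, .lower)) ⊔
      joinPair (D.inn (c, .lower)) (D.out (c, .upper)) := h₁
  have hu : D.smoothingSetoid c .unoriented = joinPair (D.inn (c, .upper)) (D.inn (c, .lower)) ⊔
      joinPair (D.out (c, .upper)) (D.out (c, .lower)) := h₁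
  have e₁ := D.underEnd_sign c
  have e₂ := D.underEnd_neg_sign c
  have e₃ := D.overEnd_sign c
  have e₄ := D.overEnd_neg_sign c
  rcases units_eq_or_eq_neg a (D.sign c) with rfl | rfl <;>
    rcases units_eq_or_eq_neg b (D.sign c) with rfl | rfl
  · rw [Smoothing.joining, if_pos rfl, ho, e₁, e₂, e₃, e₄, sup_comm, joinPair_comm (D.inn _)]
    rw [joinPair_comm (D.out _), joinPair_comm (D.out _)]
  · rw [Smoothing.joining, if_neg (units_neg_ne_self _).symm, neg_neg, hu, e₁, e₂, e₃, e₄,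
      joinPair_comm, joinPair_comm (D.out _)]
  · rw [Smoothing.joining, if_neg (units_neg_ne_self _), neg_neg, hu, e₁, e₂, e₃, e₄,
      joinPair_comm, joinPair_comm (D.out _), sup_comm]
  · rw [Smoothing.joining, if_pos rfl, neg_neg, ho, e₁, e₂, e₃, e₄, joinPair_comm]

theorem circles_eq_classCount (s : D.State) :
    D.circles s = classCount (⨆ c, D.smoothingSetoid c (s c)) := by
  have h : (⨆ c, D.smoothingSetoid c (s c)) =
      Relation.EqvGen.setoid fun a b => ∃ c, D.SmoothingJoins c (s c) a b := by
    apply le_antisymm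
    · exact iSup_le fun c => Setoid.eqvGen_le fun x y hxy => .rel _ _ ⟨c, hxy⟩
    · apply Setoid.eqvGen_le
      rintro x y ⟨c, hc⟩
      exact (le_iSup (fun c => D.smoothingSetoid c (s c)) c) (.rel _ _ hc)
  rw [h, classCount, circles]
  exact Nat.card_congr
    ⟨Quot.lift (Quotient.mk _) fun a b hab => Quotient.sound (.rel _ _ hab),
      Quotient.lift (Quot.mk _) fun a b hab => Quot.eqvGen_sound hab,
      fun q => by induction q using Quot.ind; rfl, fun q => by induction q using Quotient.ind; rfl⟩

end Ends

/-! ### State sums -/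

section StateSum

variable {V : Type*} {R : Type*} [CommRing R]

open Classical in
/-- The sum over all choices of a smoothing at each crossing in `C`, where the smoothing `t` at
`c` has coefficient `k c t` and makes the joins `J c t`, on top of the given joins `S`. -/
noncomputable def stateSum {C : Type*} [Fintype C] (δ : R) (S : Setoid V)
    (J : C → Smoothing → Setoid V) (k : C → Smoothing → R) : R :=
  ∑ s : C → Smoothing, (∏ c, k c (s c)) * δ ^ classCount (S ⊔ ⨆ c, J c (s c))

theorem stateSum_eq {C : Type*} [Fintype C] [DecidableEq C] (δ : R) (S : Setoid V)
    (J : C → Smoothing → Setoid V) (k : C → Smoothing → R) :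
    stateSum δ S J k =
      ∑ s : C → Smoothing, (∏ c, k c (s c)) * δ ^ classCount (S ⊔ ⨆ c, J c (s c)) := by
  unfold stateSum
  congr!

/-- A state sum is the sum over the smoothings at some of the crossings of the state sums over the
other crossings. -/
theorem stateSum_eq_sum {C C₀ I : Type*} [Fintype C] [Fintype C₀] [Fintype I] [DecidableEq C₀]
    (e : C₀ ⊕ I ≃ C) (δ : R) (S : Setoid V) (J : C → Smoothing → Setoid V)
    (k : C → Smoothing → R) :
    stateSum δ S J k = ∑ s : C₀ → Smoothing, (∏ c, k (e (.inl c)) (s c)) *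
      stateSum δ (S ⊔ ⨆ c, J (e (.inl c)) (s c)) (fun i => J (e (.inr i)))
        fun i => k (e (.inr i)) := by
  classical
  unfold stateSum
  rw [← Equiv.sum_comp ((Equiv.sumArrowEquivProdArrow C₀ I Smoothing).symm.trans
    (e.arrowCongr (Equiv.refl Smoothing))), Fintype.sum_prod_type]
  refine Finset.sum_congr (by congr!) fun s _ => ?_
  rw [Finset.mul_sum]
  refine Finset.sum_congr (by congr!) fun t _ => ?_
  rw [← mul_assoc, ← Equiv.prod_comp e, Fintype.prod_sum_type, ← Equiv.iSup_comp e, iSup_sum,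
    sup_assoc]
  simp

theorem sum_joining {M : Type*} [AddCommMonoid M] (F : Smoothing → M) (a b : ℤˣ) :
    ∑ t, F t = F (Smoothing.joining a b) + F (Smoothing.joining a (-b)) := by
  have h : ∑ t, F t = F .oriented + F .unoriented :=
    Finset.sum_pair (by decide)
  rw [h, Smoothing.joining, Smoothing.joining]
  rcases units_eq_or_eq_neg a b with rfl | rfl
  · rw [if_pos rfl, if_neg (units_neg_ne_self _).symm]
  · rw [if_neg (units_neg_ne_self _), if_pos rfl, add_comm]

theorem stateSum_unit (δ : R) (S : Setoid V) (J : Unit → Smoothing → Setoid V)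
    (k : Unit → Smoothing → R) :
    stateSum δ S J k = ∑ t, k () t * δ ^ classCount (S ⊔ J () t) := by
  rw [stateSum_eq, ← Equiv.sum_comp (Equiv.funUnique Unit Smoothing).symm]
  simp

theorem stateSum_fin_two (δ : R) (S : Setoid V) (J : Fin 2 → Smoothing → Setoid V)
    (k : Fin 2 → Smoothing → R) :
    stateSum δ S J k =
      ∑ t, ∑ u, (k 0 t * k 1 u) * δ ^ classCount (S ⊔ (J 0 t ⊔ J 1 u)) := by
  have h : ∀ T : Fin 2 → Setoid V, ⨆ i, T i = T 0 ⊔ T 1 := fun T =>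
    le_antisymm (iSup_le (Fin.forall_fin_two.2 ⟨le_sup_left, le_sup_right⟩))
      (sup_le (le_iSup T 0) (le_iSup T 1))
  rw [stateSum_eq, ← Equiv.sum_comp (finTwoArrowEquiv Smoothing).symm, Fintype.sum_prod_type]
  simp [h, Fin.prod_univ_two]

theorem stateSum_fin_three (δ : R) (S : Setoid V) (J : Fin 3 → Smoothing → Setoid V)
    (k : Fin 3 → Smoothing → R) :
    stateSum δ S J k = ∑ t, ∑ u, ∑ v, (k 0 t * k 1 u * k 2 v) *
      δ ^ classCount (S ⊔ (J 0 t ⊔ J 1 u ⊔ J 2 v)) := by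
  have h : ∀ T : Fin 3 → Setoid V, ⨆ i, T i = T 0 ⊔ T 1 ⊔ T 2 := fun T =>
    le_antisymm (iSup_le fun i => by
        fin_cases i
        · exact le_sup_left.trans le_sup_left
        · exact le_sup_right.trans le_sup_left
        · exact le_sup_right)
      (sup_le (sup_le (le_iSup T 0) (le_iSup T 1)) (le_iSup T 2))
  let e : Smoothing × Smoothing × Smoothing ≃ (Fin 3 → Smoothing) :=
    { toFun := fun p => ![p.1, p.2.1, p.2.2]
      invFun := fun s => (s 0, s 1, s 2)
      left_inv := fun p => rfl
      right_inv := fun s => by ext i; fin_cases i <;> rfl }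
  rw [stateSum_eq, ← Equiv.sum_comp e, Fintype.sum_prod_type]
  refine Finset.sum_congr rfl fun t _ => ?_
  rw [Fintype.sum_prod_type]
  refine Finset.sum_congr rfl fun u _ => Finset.sum_congr rfl fun v _ => ?_
  rw [h, Fin.prod_univ_three]
  rfl

variable {X : Type*} [Biquandle X]

theorem negWrithe_eq (D : LinkDiagram) : D.negWrithe = -∑ c, (D.sign c : ℤ) := by
  unfold negWrithe
  rw [Finset.card_filter, Finset.card_filter]
  push_cast
  rw [← Finset.sum_sub_distrib, ← Finset.sum_neg_distrib]
  refine Finset.sum_congr rfl fun c _ => ?_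
  rcases Int.units_eq_one_or (D.sign c) with h | h <;> rw [h] <;> decide

theorem bracketValue_eq (D : LinkDiagram) (β : BiquandleBracket X R) (f : D.Coloring X) :
    D.bracketValue β f = ((β.w ^ D.negWrithe : Rˣ) : R) *
      stateSum β.δ ⊥ D.smoothingSetoid fun c t => (D.smoothingCoeff β f c t : R) := by
  unfold bracketValue stateSum
  simp only [bot_sup_eq, circles_eq_classCount]

end StateSum
/-! ### State sums of the tangles of the moves -/

section Local

variable {V : Type*} [Finite V] {R : Type*} [CommRing R]

theorem classCount_sup_joinPair_joinPair {T : Setoid V} {e₁ e₂ x y : V} (h₁ : Isolated T e₁)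
    (h₂ : Isolated T e₂) (h₁₂ : e₁ ≠ e₂) (hx₁ : x ≠ e₁) (hx₂ : x ≠ e₂) (hy : y ≠ e₂) :
    classCount (T ⊔ joinPair e₁ x ⊔ joinPair e₂ y) + 2 = classCount T := by
  have h := (h₂.sup (isolated_joinPair h₁₂ hx₂)).classCount_sup_joinPair hy
  have h' := h₁.classCount_sup_joinPair hx₁
  omega

theorem classCount_sup_joinPair_joinPair_joinPair {T : Setoid V} {e₁ e₂ e₃ x y z : V}
    (h₁ : Isolated T e₁) (h₂ : Isolated T e₂) (h₃ : Isolated T e₃) (h₁₂ : e₁ ≠ e₂)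
    (h₁₃ : e₁ ≠ e₃) (h₂₃ : e₂ ≠ e₃) (hx₁ : x ≠ e₁) (hx₂ : x ≠ e₂) (hx₃ : x ≠ e₃)
    (hy₂ : y ≠ e₂) (hy₃ : y ≠ e₃) (hz : z ≠ e₃) :
    classCount (T ⊔ joinPair e₁ x ⊔ joinPair e₂ y ⊔ joinPair e₃ z) + 3 = classCount T := by
  have h := ((h₃.sup (isolated_joinPair h₁₃ hx₃)).sup
    (isolated_joinPair h₂₃ hy₃)).classCount_sup_joinPair hz
  have h' := classCount_sup_joinPair_joinPair h₁ h₂ h₁₂ hx₁ hx₂ hy₂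
  omega

/-- The state sum of a kink with loop `e` and ends `a` and `b` is a multiple of that of a strand. -/
theorem stateSum_kink {S : Setoid V} {e a b : V} (he : Isolated S e) (ha : a ≠ e) (hb : b ≠ e)
    {J : Smoothing → Setoid V} (hJ : J .oriented = joinPair e e ⊔ joinPair a b)
    (hJ' : J .unoriented = joinPair e b ⊔ joinPair a e) (k : Smoothing → R) (δ : R) :
    stateSum δ S (fun _ : Unit => J) (fun _ => k) =
      (δ * k .oriented + k .unoriented) *
        δ ^ classCount (S ⊔ (joinPair a e ⊔ joinPair e b)) := by
  have h := (he.sup (isolated_joinPair ha hb)).classCount_sup_joinPair ha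
  have h₁ : S ⊔ joinPair a b ⊔ joinPair e a = S ⊔ (joinPair a e ⊔ joinPair e b) :=
    eq_of_forall_ge_iff fun Y => by
      simp only [sup_le_iff, joinPair_le_iff_mk_eq]; grind
  have h₂ : S ⊔ (joinPair e b ⊔ joinPair a e) = S ⊔ (joinPair a e ⊔ joinPair e b) := by
    rw [sup_comm (joinPair e b)]
  have hs : ∀ F : Smoothing → R, ∑ t, F t = F .oriented + F .unoriented := fun F =>
    Finset.sum_pair (by decide)
  rw [stateSum_unit, hs, hJ, hJ', joinPair_self, bot_sup_eq, h₂, ← h, h₁]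
  ring

/-- Two crossings with inverse coefficients, where the strand from `a₁` to `a₂` passes over the
strand from `b₁` to `b₂` twice, have the state sum of two separate strands. The two states with one
joint of `e` and `g` and the state with two are cancelled by each other. -/
theorem stateSum_bigon {S : Setoid V} {e g a₁ a₂ b₁ b₂ : V} (he : Isolated S e)
    (hg : Isolated S g) (heg : e ≠ g) (ha₁ : a₁ ≠ e) (ha₂ : a₂ ≠ e) (hb₁ : b₁ ≠ e) (hb₂ : b₂ ≠ e)
    (ha₁' : a₁ ≠ g) (ha₂' : a₂ ≠ g) (hb₁' : b₁ ≠ g) (hb₂' : b₂ ≠ g)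
    {J : Fin 2 → Smoothing → Setoid V} {u v : ℤˣ}
    (hJ₀ : J 0 (Smoothing.joining u v) = joinPair g e ⊔ joinPair b₁ a₁)
    (hJ₀' : J 0 (Smoothing.joining u (-v)) = joinPair g a₁ ⊔ joinPair b₁ e)
    (hJ₁ : J 1 (Smoothing.joining u v) = joinPair g e ⊔ joinPair b₂ a₂)
    (hJ₁' : J 1 (Smoothing.joining u (-v)) = joinPair g a₂ ⊔ joinPair b₂ e)
    (k : Fin 2 → Smoothing → R) (δ : R)
    (h₁ : k 0 (Smoothing.joining u (-v)) * k 1 (Smoothing.joining u (-v)) = 1)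
    (h₀ : δ * (k 0 (Smoothing.joining u v) * k 1 (Smoothing.joining u v)) +
      k 0 (Smoothing.joining u v) * k 1 (Smoothing.joining u (-v)) +
      k 0 (Smoothing.joining u (-v)) * k 1 (Smoothing.joining u v) = 0) :
    stateSum δ S J k =
      δ ^ classCount (S ⊔ (joinPair a₁ e ⊔ joinPair e a₂ ⊔ (joinPair b₁ g ⊔ joinPair g b₂))) := by
  set T := S ⊔ joinPair b₁ a₁ ⊔ joinPair b₂ a₂ with hT
  have hTe : Isolated T e := (he.sup (isolated_joinPair hb₁ ha₁)).sup (isolated_joinPair hb₂ ha₂)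
  have hTg : Isolated T g :=
    (hg.sup (isolated_joinPair hb₁' ha₁')).sup (isolated_joinPair hb₂' ha₂')
  have hn := classCount_sup_joinPair_joinPair hTe hTg heg ha₁ ha₁' heg
  have hn' := classCount_sup_joinPair_joinPair hTe hTg heg ha₂ ha₂' heg
  have hn₀ := hTg.classCount_sup_joinPair heg
  have e₀ : S ⊔ (joinPair g e ⊔ joinPair b₁ a₁ ⊔ (joinPair g e ⊔ joinPair b₂ a₂)) =
      T ⊔ joinPair g e := eq_of_forall_ge_iff fun Y => by
    simp only [hT, sup_le_iff, joinPair_le_iff_mk_eq]; grind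
  have e₁ : S ⊔ (joinPair g e ⊔ joinPair b₁ a₁ ⊔ (joinPair g a₂ ⊔ joinPair b₂ e)) =
      T ⊔ joinPair e a₂ ⊔ joinPair g e := eq_of_forall_ge_iff fun Y => by
    simp only [hT, sup_le_iff, joinPair_le_iff_mk_eq]; grind
  have e₂ : S ⊔ (joinPair g a₁ ⊔ joinPair b₁ e ⊔ (joinPair g e ⊔ joinPair b₂ a₂)) =
      T ⊔ joinPair e a₁ ⊔ joinPair g e := eq_of_forall_ge_iff fun Y => by
    simp only [hT, sup_le_iff, joinPair_le_iff_mk_eq]; grind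
  -- The strands of this state are exchanged inside the bigon, but joined as in the move.
  have e₃ : classCount (S ⊔ (joinPair g a₁ ⊔ joinPair b₁ e ⊔ (joinPair g a₂ ⊔ joinPair b₂ e))) =
      classCount (S ⊔ (joinPair a₁ e ⊔ joinPair e a₂ ⊔ (joinPair b₁ g ⊔ joinPair g b₂))) := by
    set T' := S ⊔ joinPair a₁ a₂ ⊔ joinPair b₁ b₂ with hT'
    have hTe' : Isolated T' e :=
      (he.sup (isolated_joinPair ha₁ ha₂)).sup (isolated_joinPair hb₁ hb₂)
    have hTg' : Isolated T' g :=
      (hg.sup (isolated_joinPair ha₁' ha₂')).sup (isolated_joinPair hb₁' hb₂')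
    have h := classCount_sup_joinPair_joinPair hTe' hTg' heg hb₁ hb₁' ha₁'
    have h' := classCount_sup_joinPair_joinPair hTe' hTg' heg ha₁ ha₁' hb₁'
    have e₄ : S ⊔ (joinPair g a₁ ⊔ joinPair b₁ e ⊔ (joinPair g a₂ ⊔ joinPair b₂ e)) =
        T' ⊔ joinPair e b₁ ⊔ joinPair g a₁ := eq_of_forall_ge_iff fun Y => by
      simp only [hT', sup_le_iff, joinPair_le_iff_mk_eq]; grind
    have e₅ : S ⊔ (joinPair a₁ e ⊔ joinPair e a₂ ⊔ (joinPair b₁ g ⊔ joinPair g b₂)) =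
        T' ⊔ joinPair e a₁ ⊔ joinPair g b₁ := eq_of_forall_ge_iff fun Y => by
      simp only [hT', sup_le_iff, joinPair_le_iff_mk_eq]; grind
    rw [e₄, e₅]
    omega
  rw [stateSum_fin_two, sum_joining _ u v, sum_joining _ u v, sum_joining _ u v, hJ₀, hJ₀', hJ₁,
    hJ₁', e₀, e₁, e₂, e₃,
    show classCount (T ⊔ joinPair g e) = classCount (T ⊔ joinPair e a₂ ⊔ joinPair g e) + 1 by omega,
    show classCount (T ⊔ joinPair e a₁ ⊔ joinPair g e) =
      classCount (T ⊔ joinPair e a₂ ⊔ joinPair g e) by omega]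
  linear_combination
    δ ^ classCount (S ⊔ (joinPair a₁ e ⊔ joinPair e a₂ ⊔ (joinPair b₁ g ⊔ joinPair g b₂))) * h₁ +
    δ ^ classCount (T ⊔ joinPair e a₂ ⊔ joinPair g e) * h₀

/-- The number of classes when three further pairs are joined, without the three classes of the
sides of a triangle. The sides are isolated wherever this is used, so that the subtraction does not
truncate. -/
noncomputable def matchingCount (S : Setoid V) (a b c d p q : V) : ℕ :=
  classCount (S ⊔ joinPair a b ⊔ joinPair c d ⊔ joinPair p q) - 3

/-- The state sum of a triangle of crossings with sides `e₁`, `e₂`, `e₃`, grouped by the way in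
which the states join the six outer ends. At each crossing one smoothing cuts the corner of the
triangle off; the state that does so at all three crossings contains an additional circle. -/
theorem stateSum_triangle {S : Setoid V} {e₁ e₂ e₃ T₁ M₁ T₂ B₂ M₃ B₃ : V}
    (h₁ : Isolated S e₁) (h₂ : Isolated S e₂) (h₃ : Isolated S e₃)
    (h₁₂ : e₁ ≠ e₂) (h₁₃ : e₁ ≠ e₃) (h₂₃ : e₂ ≠ e₃)
    (hT₁ : T₁ ≠ e₁ ∧ T₁ ≠ e₂ ∧ T₁ ≠ e₃) (hM₁ : M₁ ≠ e₁ ∧ M₁ ≠ e₂ ∧ M₁ ≠ e₃)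
    (hT₂ : T₂ ≠ e₁ ∧ T₂ ≠ e₂ ∧ T₂ ≠ e₃) (hB₂ : B₂ ≠ e₁ ∧ B₂ ≠ e₂ ∧ B₂ ≠ e₃)
    (hM₃ : M₃ ≠ e₁ ∧ M₃ ≠ e₂ ∧ M₃ ≠ e₃) (hB₃ : B₃ ≠ e₁ ∧ B₃ ≠ e₂ ∧ B₃ ≠ e₃)
    {J : Fin 3 → Smoothing → Setoid V} {σt σm σb : ℤˣ}
    (c₀ : J 0 (Smoothing.joining σt σm) = joinPair e₂ e₁ ⊔ joinPair M₁ T₁)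
    (o₀ : J 0 (Smoothing.joining σt (-σm)) = joinPair e₂ T₁ ⊔ joinPair M₁ e₁)
    (c₁ : J 1 (Smoothing.joining σt σb) = joinPair e₃ e₁ ⊔ joinPair B₂ T₂)
    (o₁ : J 1 (Smoothing.joining σt (-σb)) = joinPair e₃ T₂ ⊔ joinPair B₂ e₁)
    (c₂ : J 2 (Smoothing.joining σm σb) = joinPair e₃ e₂ ⊔ joinPair B₃ M₃)
    (o₂ : J 2 (Smoothing.joining σm (-σb)) = joinPair e₃ M₃ ⊔ joinPair B₃ e₂)
    {k : Fin 3 → Smoothing → R} {δ x₀ y₀ x₁ y₁ x₂ y₂ : R}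
    (hx₀ : k 0 (Smoothing.joining σt σm) = x₀) (hy₀ : k 0 (Smoothing.joining σt (-σm)) = y₀)
    (hx₁ : k 1 (Smoothing.joining σt σb) = x₁) (hy₁ : k 1 (Smoothing.joining σt (-σb)) = y₁)
    (hx₂ : k 2 (Smoothing.joining σm σb) = x₂) (hy₂ : k 2 (Smoothing.joining σm (-σb)) = y₂) :
    stateSum δ S J k =
      (δ * (x₀ * x₁ * x₂) + x₀ * x₁ * y₂ + x₀ * y₁ * x₂ + y₀ * x₁ * x₂) *
          δ ^ matchingCount S M₁ T₁ B₂ T₂ B₃ M₃ +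
        x₀ * y₁ * y₂ * δ ^ matchingCount S M₁ T₁ T₂ M₃ B₂ B₃ +
        y₀ * x₁ * y₂ * δ ^ matchingCount S B₂ T₂ T₁ B₃ M₁ M₃ +
        y₀ * y₁ * x₂ * δ ^ matchingCount S B₃ M₃ T₁ T₂ M₁ B₂ +
        y₀ * y₁ * y₂ * δ ^ matchingCount S T₁ B₃ M₁ B₂ T₂ M₃ := by
  have iso : ∀ {a b c d p q e : V}, Isolated S e → a ≠ e → b ≠ e → c ≠ e → d ≠ e → p ≠ e →
      q ≠ e → Isolated (S ⊔ joinPair a b ⊔ joinPair c d ⊔ joinPair p q) e :=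
    fun h ha hb hc hd hp hq => ((h.sup (isolated_joinPair ha hb)).sup
      (isolated_joinPair hc hd)).sup (isolated_joinPair hp hq)
  have count : ∀ {Y : Setoid V} {a b c d p q x y z : V},
      (a ≠ e₁ ∧ a ≠ e₂ ∧ a ≠ e₃) → (b ≠ e₁ ∧ b ≠ e₂ ∧ b ≠ e₃) → (c ≠ e₁ ∧ c ≠ e₂ ∧ c ≠ e₃) →
      (d ≠ e₁ ∧ d ≠ e₂ ∧ d ≠ e₃) → (p ≠ e₁ ∧ p ≠ e₂ ∧ p ≠ e₃) → (q ≠ e₁ ∧ q ≠ e₂ ∧ q ≠ e₃) →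
      (x ≠ e₁ ∧ x ≠ e₂ ∧ x ≠ e₃) → (y ≠ e₁ ∧ y ≠ e₂ ∧ y ≠ e₃) → (z ≠ e₁ ∧ z ≠ e₂ ∧ z ≠ e₃) →
      Y = S ⊔ joinPair a b ⊔ joinPair c d ⊔ joinPair p q ⊔ joinPair e₁ x ⊔ joinPair e₂ y ⊔
        joinPair e₃ z → classCount Y = matchingCount S a b c d p q := by
    rintro Y a b c d p q x y z ha hb hc hd hp hq hx hy hz rfl
    have h := classCount_sup_joinPair_joinPair_joinPair
      (iso h₁ ha.1 hb.1 hc.1 hd.1 hp.1 hq.1) (iso h₂ ha.2.1 hb.2.1 hc.2.1 hd.2.1 hp.2.1 hq.2.1)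
      (iso h₃ ha.2.2 hb.2.2 hc.2.2 hd.2.2 hp.2.2 hq.2.2) h₁₂ h₁₃ h₂₃ hx.1 hx.2.1 hx.2.2
      hy.2.1 hy.2.2 hz.2.2
    unfold matchingCount
    omega
  have loop : classCount (S ⊔ (joinPair e₂ e₁ ⊔ joinPair M₁ T₁ ⊔ (joinPair e₃ e₁ ⊔ joinPair B₂ T₂) ⊔
      (joinPair e₃ e₂ ⊔ joinPair B₃ M₃))) = matchingCount S M₁ T₁ B₂ T₂ B₃ M₃ + 1 := by
    have i₁ := iso h₁ hM₁.1 hT₁.1 hB₂.1 hT₂.1 hB₃.1 hM₃.1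
    have i₂ := iso h₂ hM₁.2.1 hT₁.2.1 hB₂.2.1 hT₂.2.1 hB₃.2.1 hM₃.2.1
    have i₃ := iso h₃ hM₁.2.2 hT₁.2.2 hB₂.2.2 hT₂.2.2 hB₃.2.2 hM₃.2.2
    have h := classCount_sup_joinPair_joinPair i₂ i₃ h₂₃ h₁₂ h₁₃ h₁₃
    have h' := classCount_sup_joinPair_joinPair_joinPair i₁ i₂ i₃ h₁₂ h₁₃ h₂₃ hT₁.1 hT₁.2.1
      hT₁.2.2 hT₁.2.1 hT₁.2.2 hT₁.2.2
    have e : S ⊔ (joinPair e₂ e₁ ⊔ joinPair M₁ T₁ ⊔ (joinPair e₃ e₁ ⊔ joinPair B₂ T₂) ⊔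
        (joinPair e₃ e₂ ⊔ joinPair B₃ M₃)) = S ⊔ joinPair M₁ T₁ ⊔ joinPair B₂ T₂ ⊔
          joinPair B₃ M₃ ⊔ joinPair e₂ e₁ ⊔ joinPair e₃ e₁ := eq_of_forall_ge_iff fun Y => by
      simp only [sup_le_iff, joinPair_le_iff_mk_eq]; grind
    rw [e]
    unfold matchingCount
    omega
  rw [stateSum_fin_three, Finset.sum_congr rfl fun t _ => Finset.sum_congr rfl fun u _ =>
    sum_joining _ σm σb, Finset.sum_congr rfl fun t _ => sum_joining _ σt σb, sum_joining _ σt σm]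
  rw [c₀, c₁, c₂, o₀, o₁, o₂, hx₀, hx₁, hx₂, hy₀, hy₁, hy₂, loop,
    count hM₁ hT₁ hB₂ hT₂ hB₃ hM₃ hB₃ hB₃ hB₃ (eq_of_forall_ge_iff fun Y => by
      simp only [sup_le_iff, joinPair_le_iff_mk_eq]; grind),
    count hM₁ hT₁ hB₂ hT₂ hB₃ hM₃ hT₂ hT₂ hT₂ (eq_of_forall_ge_iff fun Y => by
      simp only [sup_le_iff, joinPair_le_iff_mk_eq]; grind),
    count hM₁ hT₁ hT₂ hM₃ hB₂ hB₃ hB₂ hB₂ hT₂ (eq_of_forall_ge_iff fun Y => by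
      simp only [sup_le_iff, joinPair_le_iff_mk_eq]; grind),
    count hM₁ hT₁ hB₂ hT₂ hB₃ hM₃ hT₁ hT₁ hT₁ (eq_of_forall_ge_iff fun Y => by
      simp only [sup_le_iff, joinPair_le_iff_mk_eq]; grind),
    count hB₂ hT₂ hT₁ hB₃ hM₁ hM₃ hM₁ hT₁ hM₃ (eq_of_forall_ge_iff fun Y => by
      simp only [sup_le_iff, joinPair_le_iff_mk_eq]; grind),
    count hB₃ hM₃ hT₁ hT₂ hM₁ hB₂ hM₁ hT₁ hT₂ (eq_of_forall_ge_iff fun Y => by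
      simp only [sup_le_iff, joinPair_le_iff_mk_eq]; grind),
    count hT₁ hB₃ hM₁ hB₂ hT₂ hM₃ hM₁ hT₁ hT₂ (eq_of_forall_ge_iff fun Y => by
      simp only [sup_le_iff, joinPair_le_iff_mk_eq]; grind)]
  ring

end Local
end LinkDiagram

/-! ### Colorings of a crossing and of a triangle -/

section Faces

variable {X : Type*} [Biquandle X]

/-- The condition on the colors `u 1`, `o 1` on the left and `u (-1)`, `o (-1)` on the right of the
under- and the over-strand at a crossing. -/
structure IsFace (u o : ℤˣ → X) : Prop where
  right_under : u (-1) = Biquandle.underOp (u 1) (o 1)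
  right_over : o (-1) = Biquandle.overOp (o 1) (u 1)

theorem units_funext {α : Type*} {u v : ℤˣ → α} (h₁ : u 1 = v 1) (h₂ : u (-1) = v (-1)) :
    u = v := by
  funext a
  rcases Int.units_eq_one_or a with rfl | rfl <;> assumption

theorem units_funext_of {α : Type*} {u v : ℤˣ → α} (a : ℤˣ) (h₁ : u a = v a)
    (h₂ : u (-a) = v (-a)) : u = v := by
  rcases Int.units_eq_one_or a with rfl | rfl
  · exact units_funext h₁ h₂
  · exact units_funext h₂ h₁

/-- The colors at a crossing are determined by the color of any one end of each strand. -/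
theorem IsFace.ext {u o u' o' : ℤˣ → X} (h : IsFace u o) (h' : IsFace u' o') (a b : ℤˣ)
    (hu : u a = u' a) (ho : o b = o' b) : u = u' ∧ o = o' := by
  have key : u 1 = u' 1 → o 1 = o' 1 → u = u' ∧ o = o' := fun e₁ e₂ =>
    ⟨units_funext e₁ (by rw [h.right_under, h'.right_under, e₁, e₂]),
      units_funext e₂ (by rw [h.right_over, h'.right_over, e₁, e₂])⟩
  rcases Int.units_eq_one_or a with rfl | rfl <;> rcases Int.units_eq_one_or b with rfl | rfl
  · exact key hu ho
  · refine key hu ((Biquandle.over_bijective (u 1)).1 ?_)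
    change Biquandle.overOp (o 1) (u 1) = Biquandle.overOp (o' 1) (u 1)
    rw [← h.right_over, ho, h'.right_over, hu]
  · refine key ((Biquandle.under_bijective (o 1)).1 ?_) ho
    change Biquandle.underOp (u 1) (o 1) = Biquandle.underOp (u' 1) (o 1)
    rw [← h.right_under, hu, h'.right_under, ho]
  · have := @(Biquandle.side_bijective (X := X)).1 (u 1, o 1) (u' 1, o' 1)
      (by
        simp only
        rw [← h.right_over, ← h.right_under, ← h'.right_over, ← h'.right_under, hu, ho])
    rw [Prod.mk.injEq] at this
    exact key this.1 this.2

theorem IsFace.mk' (x y : X) : IsFace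
    (fun a : ℤˣ => if a = 1 then x else Biquandle.underOp x y)
    (fun a : ℤˣ => if a = 1 then y else Biquandle.overOp y x) where
  right_under := by simp
  right_over := by simp

theorem exists_isFace (a b : ℤˣ) (x y : X) : ∃ u o, IsFace u o ∧ u a = x ∧ o b = y := by
  rcases Int.units_eq_one_or a with rfl | rfl <;> rcases Int.units_eq_one_or b with rfl | rfl
  · exact ⟨_, _, IsFace.mk' x y, by simp, by simp⟩
  · obtain ⟨z, hz⟩ := (Biquandle.over_bijective x).2 y
    exact ⟨_, _, IsFace.mk' x z, by simp, by simpa using hz⟩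
  · obtain ⟨z, hz⟩ := (Biquandle.under_bijective y).2 x
    exact ⟨_, _, IsFace.mk' z y, by simpa using hz, by simp⟩
  · obtain ⟨⟨z, z'⟩, hz⟩ := (Biquandle.side_bijective (X := X)).2 (y, x)
    simp only [Prod.mk.injEq] at hz
    exact ⟨_, _, IsFace.mk' z z', by simpa using hz.2, by simpa using hz.1⟩

/-- Every color is carried by both right ends at a crossing whose left ends carry equal colors. As
`X` is finite, this follows from the injectivity of `x ↦ underOp x x`. -/
theorem exists_isFace_self [Finite X] (a : ℤˣ) (x : X) : ∃ u : ℤˣ → X, IsFace u u ∧ u a = x := by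
  have mk : ∀ y : X, ∃ u : ℤˣ → X, IsFace u u ∧ u 1 = y := fun y =>
    ⟨fun a => if a = 1 then y else Biquandle.underOp y y,
      ⟨by simp, by simp [Biquandle.under_self]⟩, by simp⟩
  rcases Int.units_eq_one_or a with rfl | rfl
  · exact mk x
  · have inj : Function.Injective fun y : X => Biquandle.underOp y y := by
      intro y z h
      obtain ⟨u, hu, rfl⟩ := mk y
      obtain ⟨v, hv, rfl⟩ := mk z
      have e : u (-1) = v (-1) := by rw [hu.right_under, hv.right_under]; exact h
      rw [(hu.ext hv (-1) (-1) e e).1]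
    obtain ⟨y, hy⟩ := Finite.surjective_of_injective inj x
    obtain ⟨u, hu, rfl⟩ := mk y
    exact ⟨u, hu, by rw [hu.right_under]; exact hy⟩

/-- If the two strands have equal colors at one side of a crossing, then also at the other. -/
theorem IsFace.eq_of_eq [Finite X] {u o : ℤˣ → X} (h : IsFace u o) {a : ℤˣ} (ha : u a = o a) :
    u = o := by
  obtain ⟨v, hv, hva⟩ := exists_isFace_self a (u a)
  obtain ⟨h₁, h₂⟩ := h.ext hv a a hva.symm (ha.symm.trans hva.symm)
  rw [h₁, h₂]

/-- Colors for three strands in general position and their images under a type III move. The top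
strand has the color `T m b` where it lies on the side `m` of the middle and on the side `b` of the
bottom strand; similarly for the colors `M t b` of the middle and `B t m` of the bottom strand.
The twelve colors are those of the edges of a cube whose six faces are the three crossings before
and the three crossings after the move. -/
structure IsCube (T M B : ℤˣ → ℤˣ → X) : Prop where
  top_middle : ∀ b, IsFace (fun t => M t b) (fun m => T m b)
  top_bottom : ∀ m, IsFace (fun t => B t m) (fun b => T m b)
  middle_bottom : ∀ t, IsFace (fun m => B t m) (fun b => M t b)

/-- The exchange laws say that the colors at one vertex of the cube can be extended. -/
theorem exists_isCube_one (x y z : X) :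
    ∃ T M B : ℤˣ → ℤˣ → X, IsCube T M B ∧ T 1 1 = z ∧ M 1 1 = y ∧ B 1 1 = x := by
  have n : (-1 : ℤˣ) ≠ 1 := by decide
  refine ⟨fun m b => if m = 1 then (if b = 1 then z else Biquandle.overOp z x) else
      if b = 1 then Biquandle.overOp z y else
        Biquandle.overOp (Biquandle.overOp z x) (Biquandle.overOp y x),
    fun t b => if t = 1 then (if b = 1 then y else Biquandle.overOp y x) else
      if b = 1 then Biquandle.underOp y z else
        Biquandle.underOp (Biquandle.overOp y x) (Biquandle.overOp z x),
    fun t m => if t = 1 then (if m = 1 then x else Biquandle.underOp x y) else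
      if m = 1 then Biquandle.underOp x z else
        Biquandle.underOp (Biquandle.underOp x z) (Biquandle.underOp y z), ⟨?_, ?_, ?_⟩, ?_⟩
  · intro b
    rcases Int.units_eq_one_or b with rfl | rfl <;> constructor <;> simp [n]
  · intro b
    rcases Int.units_eq_one_or b with rfl | rfl <;> constructor <;>
      simp [n, Biquandle.exchange_under_under, Biquandle.exchange_over_over]
  · intro b
    rcases Int.units_eq_one_or b with rfl | rfl <;> constructor <;>
      simp [n, Biquandle.exchange_under_over]
  · simp

theorem IsCube.ext {T M B T' M' B' : ℤˣ → ℤˣ → X} (h : IsCube T M B) (h' : IsCube T' M' B')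
    (σt σm σb : ℤˣ) (hT : T σm σb = T' σm σb) (hM : M σt σb = M' σt σb)
    (hB : B σt σm = B' σt σm) : T = T' ∧ M = M' ∧ B = B' := by
  have e₁ := (h.top_middle σb).ext (h'.top_middle σb) σt σm hM hT
  have e₂ := (h.top_bottom σm).ext (h'.top_bottom σm) σt σb hB hT
  have e₃ := (h.middle_bottom σt).ext (h'.middle_bottom σt) σm σb hB hM
  have e₄ := (h.top_middle (-σb)).ext (h'.top_middle (-σb)) σt σm (congrFun e₃.2 _)
    (congrFun e₂.2 _)
  have e₅ := (h.top_bottom (-σm)).ext (h'.top_bottom (-σm)) σt σb (congrFun e₃.1 _)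
    (congrFun e₁.2 _)
  have e₆ := (h.middle_bottom (-σt)).ext (h'.middle_bottom (-σt)) σm σb (congrFun e₂.1 _)
    (congrFun e₁.1 _)
  exact ⟨units_funext_of σm e₂.2 e₅.2, units_funext_of σt e₃.2 e₆.2, units_funext_of σt e₃.1 e₆.1⟩

/-- The colors at any vertex of the cube can be extended: for the vertex `(1, 1, 1)` these are the
exchange laws, and the number of cubes that they provide suffices for the other vertices. -/
theorem exists_isCube [Finite X] (σt σm σb : ℤˣ) (x y z : X) :
    ∃ T M B : ℤˣ → ℤˣ → X, IsCube T M B ∧ T σm σb = z ∧ M σt σb = y ∧ B σt σm = x := by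
  choose T M B h hT hM hB using fun p : X × X × X => exists_isCube_one p.1 p.2.1 p.2.2
  have inj : Function.Injective fun p => (B p σt σm, M p σt σb, T p σm σb) := by
    intro p q hpq
    simp only [Prod.mk.injEq] at hpq
    obtain ⟨e₁, e₂, e₃⟩ := (h p).ext (h q) σt σm σb hpq.2.2 hpq.2.1 hpq.1
    refine Prod.ext ?_ (Prod.ext ?_ ?_)
    · rw [← hB p, ← hB q, e₃]
    · rw [← hM p, ← hM q, e₂]
    · rw [← hT p, ← hT q, e₁]
  obtain ⟨p, hp⟩ := Finite.surjective_of_injective inj (x, y, z)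
  simp only [Prod.mk.injEq] at hp
  exact ⟨T p, M p, B p, h p, hp.2.2, hp.2.1, hp.1⟩

end Faces

/-! ### The bracket equations at a triangle -/

section Weights

variable {R : Type*} [CommRing R]

/-- The relations between the ratios `uᵢ` of the two coefficients at the three crossings of a
triangle. Here `lam` is the factor by which the ratios change under the move. -/
structure TriangleRatios (δ lam u₁ u₂ u₃ : R) : Prop where
  sq : lam ^ 2 = 1
  mul_lam : δ * lam = δ
  quad₁ : u₁ ^ 2 + δ * u₁ + 1 = 0
  quad₂ : u₂ ^ 2 + δ * u₂ + 1 = 0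
  quad₃ : u₃ ^ 2 + δ * u₃ + 1 = 0
  triple : δ * (u₁ * u₂ * u₃) + u₁ * u₂ + u₁ * u₃ + u₂ * u₃ = lam

namespace TriangleRatios

variable {δ lam u₁ u₂ u₃ : R}

theorem rotate (h : TriangleRatios δ lam u₁ u₂ u₃) : TriangleRatios δ lam u₂ u₃ u₁ :=
  ⟨h.sq, h.mul_lam, h.quad₂, h.quad₃, h.quad₁, by rw [← h.triple]; ring⟩

theorem lam_mul (h : TriangleRatios δ lam u₁ u₂ u₃) :
    lam * u₁ = u₁ * u₂ * u₃ - δ - u₂ - u₃ := by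
  linear_combination (-u₁ - δ) * h.triple + (δ * (u₂ * u₃) + u₂ + u₃) * h.quad₁ - h.mul_lam

/-- The ratios agree up to multiples of the annihilator of `lam - 1`. -/
theorem sub_one_mul_sub (h : TriangleRatios δ lam u₁ u₂ u₃) : (lam - 1) * (u₁ - u₂) = 0 := by
  linear_combination h.lam_mul - h.rotate.lam_mul

theorem two_mul (h : TriangleRatios δ lam u₁ u₂ u₃) : 2 * (lam - 1) = 0 := by
  have h₁₂ := h.sub_one_mul_sub
  have h₃₁ := h.rotate.rotate.sub_one_mul_sub
  linear_combination (-(lam - 1)) * h.triple + (u₁ * u₂ * u₃ - 3 * u₁) * h.mul_lam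
    + 3 * (lam - 1) * h.quad₁ - (u₁ + u₃) * h₁₂ + 2 * u₁ * h₃₁ - h.sq

theorem scale (h : TriangleRatios δ lam u₁ u₂ u₃) : TriangleRatios δ lam (lam * u₁) u₂ u₃ where
  sq := h.sq
  mul_lam := h.mul_lam
  quad₁ := by linear_combination u₁ ^ 2 * h.sq + u₁ * h.mul_lam + h.quad₁
  quad₂ := h.quad₂
  quad₃ := h.quad₃
  triple := by
    linear_combination h.triple + (u₁ * u₂ * u₃) * h.mul_lam - u₁ * h.rotate.sub_one_mul_sub
      + u₁ * u₂ * h.two_mul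

/-- The reciprocal of a ratio `u` is `-δ - u`. -/
theorem inv (h : TriangleRatios δ lam u₁ u₂ u₃) {v₁ v₂ v₃ : R} (h₁ : u₁ * v₁ = 1)
    (h₂ : u₂ * v₂ = 1) (h₃ : u₃ * v₃ = 1) : TriangleRatios δ lam v₁ v₂ v₃ where
  sq := h.sq
  mul_lam := h.mul_lam
  quad₁ := by linear_combination v₁ ^ 2 * h.quad₁ - (u₁ * v₁ + 1 + δ * v₁) * h₁
  quad₂ := by linear_combination v₂ ^ 2 * h.quad₂ - (u₂ * v₂ + 1 + δ * v₂) * h₂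
  quad₃ := by linear_combination v₃ ^ 2 * h.quad₃ - (u₃ * v₃ + 1 + δ * v₃) * h₃
  triple := by
    have e : δ + u₁ + u₂ + u₃ = lam * (u₁ * u₂ * u₃) := by
      linear_combination lam * h.lam_mul - u₁ * h.sq - h.mul_lam - u₂ * h.two_mul
        + h.rotate.sub_one_mul_sub
    have p : u₁ * u₂ * u₃ * (v₁ * v₂ * v₃) = 1 := by
      linear_combination u₂ * v₂ * (u₃ * v₃) * h₁ + u₃ * v₃ * h₂ + h₃
    linear_combination (v₁ * v₂ * v₃) * e + lam * p - v₂ * v₃ * h₁ - v₁ * v₃ * h₂ - v₁ * v₂ * h₃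

end TriangleRatios

/-- The identities between the coefficients of a triangle and of its image under a type III move
that make the state sums agree; `xᵢ` belongs to the smoothing that cuts the corner of the triangle
off and `yᵢ` to the other one. -/
structure TriangleIdentity (δ x₁ y₁ x₂ y₂ x₃ y₃ x₁' y₁' x₂' y₂' x₃' y₃' : R) : Prop where
  cut₁ : x₁ * y₂ * y₃ = x₁' * y₂' * y₃'
  cut₂ : y₁ * x₂ * y₃ = y₁' * x₂' * y₃'
  cut₃ : y₁ * y₂ * x₃ = y₁' * y₂' * x₃'
  cut_none : y₁ * y₂ * y₃ =
    δ * (x₁' * x₂' * x₃') + x₁' * x₂' * y₃' + x₁' * y₂' * x₃' + y₁' * x₂' * x₃'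
  cut_most : δ * (x₁ * x₂ * x₃) + x₁ * x₂ * y₃ + x₁ * y₂ * x₃ + y₁ * x₂ * x₃ = y₁' * y₂' * y₃'

theorem TriangleRatios.triangleIdentity {δ lam u₁ u₂ u₃ y₁ y₂ y₃ y₁' y₂' y₃' : R}
    (h : TriangleRatios δ lam u₁ u₂ u₃) (hy : y₁ * y₂ * y₃ = lam * (y₁' * y₂' * y₃')) :
    TriangleIdentity δ (u₁ * y₁) y₁ (u₂ * y₂) y₂ (u₃ * y₃) y₃
      (lam * u₁ * y₁') y₁' (lam * u₂ * y₂') y₂' (lam * u₃ * y₃') y₃' where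
  cut₁ := by linear_combination u₁ * hy
  cut₂ := by linear_combination u₂ * hy
  cut₃ := by linear_combination u₃ * hy
  cut_none := by
    have h' := h.scale.rotate.scale.rotate.scale.rotate.triple
    linear_combination hy - (y₁' * y₂' * y₃') * h'
  cut_most := by
    linear_combination (y₁ * y₂ * y₃) * h.triple + lam * hy + (y₁' * y₂' * y₃') * h.sq

/-- The coefficient of a smoothing at a crossing of sign `s` with coefficients `A` and `B`. -/
def crossingWeight (A B : Rˣ) (s : ℤˣ) : LinkDiagram.Smoothing → Rˣ
  | .oriented => A ^ (s : ℤ)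
  | .unoriented => B ^ (s : ℤ)

/-- The bracket equations for the crossings of three strands, top and middle (`A₁`, `B₁`), top and
bottom (`A₂`, `B₂`), middle and bottom (`A₃`, `B₃`), each on both sides of the third strand. -/
structure TriangleWeights (δ : R) (A₁ B₁ A₂ B₂ A₃ B₃ : ℤˣ → Rˣ) : Prop where
  loop₁ : ∀ a, δ = -((A₁ a : R) * ((B₁ a)⁻¹ : Rˣ)) - ((A₁ a)⁻¹ : Rˣ) * (B₁ a : R)
  loop₂ : ∀ a, δ = -((A₂ a : R) * ((B₂ a)⁻¹ : Rˣ)) - ((A₂ a)⁻¹ : Rˣ) * (B₂ a : R)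
  loop₃ : ∀ a, δ = -((A₃ a : R) * ((B₃ a)⁻¹ : Rˣ)) - ((A₃ a)⁻¹ : Rˣ) * (B₃ a : R)
  three_AAA : A₃ 1 * A₁ 1 * A₂ (-1) = A₂ 1 * A₁ (-1) * A₃ (-1)
  three_ABB : A₃ 1 * B₁ 1 * B₂ (-1) = B₂ 1 * B₁ (-1) * A₃ (-1)
  three_BAB : B₃ 1 * A₁ 1 * B₂ (-1) = B₂ 1 * A₁ (-1) * B₃ (-1)
  three_AAB : (A₃ 1 * A₁ 1 * B₂ (-1) : R) = A₂ 1 * B₁ (-1) * A₃ (-1) + A₂ 1 * A₁ (-1) * B₃ (-1) +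
    δ * A₂ 1 * B₁ (-1) * B₃ (-1) + B₂ 1 * B₁ (-1) * B₃ (-1)
  three_BAA : (B₃ 1 * A₁ 1 * A₂ (-1) + A₃ 1 * B₁ 1 * A₂ (-1) + δ * B₃ 1 * B₁ 1 * A₂ (-1) +
    B₃ 1 * B₁ 1 * B₂ (-1) : R) = B₂ 1 * A₁ (-1) * A₃ (-1)

theorem units_ratio_quad {δ : R} {A B t : Rˣ} (hB : B = A * t)
    (h : δ = -((A : R) * (B⁻¹ : Rˣ)) - (A⁻¹ : Rˣ) * (B : R)) : (t : R) ^ 2 + δ * t + 1 = 0 := by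
  subst hB
  have e₁ : (A : R) * (((A * t)⁻¹ : Rˣ) : R) = ((t⁻¹ : Rˣ) : R) := by
    rw [← Units.val_mul, mul_inv, mul_inv_cancel_left]
  have e₂ : ((A⁻¹ : Rˣ) : R) * ((A * t : Rˣ) : R) = t := by
    rw [← Units.val_mul, inv_mul_cancel_left]
  rw [e₁, e₂] at h
  rw [h]
  linear_combination -(t.inv_mul)

/-- The ratios `B / A` at the same two strands, on the two sides of the third one, differ by the
same factor for any two of the strands. -/
theorem TriangleWeights.exists_ratios {δ : R} {A₁ B₁ A₂ B₂ A₃ B₃ : ℤˣ → Rˣ}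
    (h : TriangleWeights δ A₁ B₁ A₂ B₂ A₃ B₃) :
    ∃ (lam : Rˣ) (t₁ t₂ t₃ : ℤˣ → Rˣ), (∀ a, B₁ a = A₁ a * t₁ a) ∧ (∀ a, B₂ a = A₂ a * t₂ a) ∧
      (∀ a, B₃ a = A₃ a * t₃ a) ∧ (∀ a, t₁ (-a) = lam * t₁ a) ∧ (∀ a, t₂ (-a) = lam * t₂ a) ∧
      (∀ a, t₃ (-a) = lam * t₃ a) ∧
      TriangleRatios δ (lam : R) (t₁ 1) ((t₂ (-1))⁻¹ : Rˣ) (t₃ 1) := by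
  have ratio : ∀ A B : ℤˣ → Rˣ, ∃ t : ℤˣ → Rˣ, ∀ a, B a = A a * t a := fun A B =>
    ⟨fun a => (A a)⁻¹ * B a, fun a => (mul_inv_cancel_left _ _).symm⟩
  obtain ⟨t₁, ht₁⟩ := ratio A₁ B₁
  obtain ⟨t₂, ht₂⟩ := ratio A₂ B₂
  obtain ⟨t₃, ht₃⟩ := ratio A₃ B₃
  obtain ⟨lam, hlam⟩ : ∃ lam, t₁ (-1) = lam * t₁ 1 := ⟨t₁ (-1) * (t₁ 1)⁻¹, by simp⟩
  have hAAA := congrArg (Units.val) h.three_AAA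
  have hABB := congrArg (Units.val) h.three_ABB
  have hBAB := congrArg (Units.val) h.three_BAB
  have hAAB := h.three_AAB
  have hBAA := h.three_BAA
  simp only [ht₁, ht₂, ht₃, Units.val_mul] at hAAA hABB hBAB hAAB hBAA
  have q₁ := fun a => units_ratio_quad (ht₁ a) (h.loop₁ a)
  have q₂ := fun a => units_ratio_quad (ht₂ a) (h.loop₂ a)
  have q₃ := fun a => units_ratio_quad (ht₃ a) (h.loop₃ a)
  have hlam' := congrArg (Units.val) hlam
  rw [Units.val_mul] at hlam'
  -- Each equation is divided by the one between the products of the coefficients `A`.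
  have cancel : ∀ {x y : R}, (A₃ 1 * A₁ 1 * A₂ (-1) : R) * x = (A₃ 1 * A₁ 1 * A₂ (-1) : R) * y →
      x = y := fun {x y} e => by
    have := (A₃ 1 * A₁ 1 * A₂ (-1)).isUnit.mul_left_cancel (b := x) (c := y)
    exact this (by simpa only [Units.val_mul] using e)
  have e₂ : (t₂ (-1) : R) = lam * t₂ 1 := by
    refine (t₁ 1).isUnit.mul_left_cancel (cancel ?_)
    linear_combination hABB - (t₂ 1 * t₁ (-1) : R) * hAAA +
      (A₃ 1 * A₁ 1 * A₂ (-1) * t₂ 1 : R) * hlam'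
  have e₃ : (t₃ (-1) : R) = lam * t₃ 1 := by
    refine (t₂ 1).isUnit.mul_left_cancel (cancel ?_)
    linear_combination -hBAB + (t₂ 1 * t₃ (-1) : R) * hAAA +
      (A₃ 1 * A₁ 1 * A₂ (-1) * t₃ 1 : R) * e₂
  have f₁ : (t₂ (-1) : R) = t₁ (-1) + t₃ (-1) + δ * t₁ (-1) * t₃ (-1) +
      t₂ 1 * t₁ (-1) * t₃ (-1) := by
    refine cancel ?_
    linear_combination hAAB - (t₁ (-1) + t₃ (-1) + δ * t₁ (-1) * t₃ (-1) +
      t₂ 1 * t₁ (-1) * t₃ (-1) : R) * hAAA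
  have f₂ : (t₃ 1 + t₁ 1 + δ * t₃ 1 * t₁ 1 + t₃ 1 * t₁ 1 * t₂ (-1) : R) = t₂ 1 := by
    refine cancel ?_
    linear_combination hBAA - (t₂ 1 : R) * hAAA
  rw [hlam', e₂, e₃] at f₁
  rw [e₂] at f₂
  have hδ : δ * (lam : R) = δ := by
    refine (lam * t₁ 1 * t₃ 1).isUnit.mul_left_cancel ?_
    simp only [Units.val_mul]
    linear_combination -(lam : R) * f₂ - f₁
  have hsq : (lam : R) ^ 2 = 1 := by
    have q := q₁ (-1)
    rw [hlam'] at q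
    refine (t₁ 1 * t₁ 1).isUnit.mul_left_cancel ?_
    simp only [Units.val_mul]
    linear_combination q - q₁ 1 - t₁ 1 * hδ
  have hsq' : lam * lam = 1 := Units.ext (by simpa [sq] using hsq)
  have both : ∀ t : ℤˣ → Rˣ, (t (-1) : R) = lam * t 1 → ∀ a, t (-a) = lam * t a := by
    intro t ht a
    have ht' : t (-1) = lam * t 1 := Units.ext (by simpa using ht)
    rcases Int.units_eq_one_or a with rfl | rfl
    · exact ht'
    · rw [neg_neg, ht', ← mul_assoc, hsq', one_mul]
  have hv : (t₂ (-1) : R) * ((t₂ (-1))⁻¹ : Rˣ) = 1 := Units.mul_inv _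
  have q₂' := q₂ (-1)
  refine ⟨lam, t₁, t₂, t₃, ht₁, ht₂, ht₃, both t₁ hlam', both t₂ e₂, both t₃ e₃, hsq, hδ, q₁ 1, ?_,
    q₃ 1, ?_⟩
  all_goals
    generalize (((t₂ (-1))⁻¹ : Rˣ) : R) = v at hv ⊢
    rw [e₂] at hv q₂'
  · linear_combination v ^ 2 * q₂' - (lam * t₂ 1 * v + 1 + δ * v) * hv
  · linear_combination v * f₂ + (lam - t₃ 1 * t₁ 1) * hv - t₂ 1 * v * hsq

theorem units_zpow_eq {G : Type*} [CommGroup G] (A : ℤˣ → G) (a n : ℤˣ) :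
    A a ^ (n : ℤ) = A (-a) ^ (n : ℤ) * (A 1 * (A (-1))⁻¹) ^ ((a * n : ℤˣ) : ℤ) := by
  rcases Int.units_eq_one_or a with rfl | rfl <;> rcases Int.units_eq_one_or n with rfl | rfl <;>
    simp

theorem zpow_eq_lam_mul {G : Type*} [CommGroup G] {t : ℤˣ → G} {lam : G}
    (ht : ∀ a, t (-a) = lam * t a) (hlam : lam * lam = 1) (a n : ℤˣ) :
    t a ^ (n : ℤ) = lam * t (-a) ^ (n : ℤ) := by
  rcases Int.units_eq_one_or n with rfl | rfl
  · simp [ht, ← mul_assoc, hlam]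
  · simp [ht, mul_comm]

/-- The smoothings at a crossing have coefficients of ratio `t` or `t⁻¹`. -/
theorem crossingWeight_joining {A B t : Rˣ} (hB : B = A * t) (s x y : ℤˣ) :
    crossingWeight A B s (.joining x y) =
      t ^ ((-(x * y * s) : ℤˣ) : ℤ) * crossingWeight A B s (.joining x (-y)) := by
  subst hB
  rcases LinkDiagram.units_eq_or_eq_neg x y with rfl | rfl
  · have e : LinkDiagram.Smoothing.joining x (-x) = .unoriented :=
      if_neg (LinkDiagram.units_neg_ne_self x).symm
    have e' : LinkDiagram.Smoothing.joining x x = .oriented := if_pos rfl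
    rw [e, e', crossingWeight, crossingWeight, Int.units_mul_self, one_mul, mul_zpow,
      Units.val_neg, zpow_neg, mul_left_comm, inv_mul_cancel, mul_one]
  · have e : LinkDiagram.Smoothing.joining (-y) (-y) = .oriented := if_pos rfl
    have e' : LinkDiagram.Smoothing.joining (-y) y = .unoriented :=
      if_neg (LinkDiagram.units_neg_ne_self y)
    rw [e, e', crossingWeight, crossingWeight, neg_mul, neg_mul, neg_neg, Int.units_mul_self,
      one_mul, mul_zpow, mul_comm]

theorem crossingWeight_eq {A B t : ℤˣ → Rˣ} {lam : Rˣ} (hB : ∀ a, B a = A a * t a)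
    (ht : ∀ a, t (-a) = lam * t a) (hlam : lam * lam = 1) (a s x y : ℤˣ) :
    crossingWeight (A a) (B a) s (.joining x (-y)) =
      crossingWeight (A (-a)) (B (-a)) s (.joining x (-y)) *
        (A 1 * (A (-1))⁻¹) ^ ((a * s : ℤˣ) : ℤ) * if x = y then lam else 1 := by
  rcases LinkDiagram.units_eq_or_eq_neg x y with rfl | rfl
  · have e : LinkDiagram.Smoothing.joining x (-x) = .unoriented :=
      if_neg (LinkDiagram.units_neg_ne_self x).symm
    rw [e, if_pos rfl, crossingWeight, crossingWeight, hB, hB, mul_zpow, mul_zpow,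
      zpow_eq_lam_mul ht hlam a, units_zpow_eq A a, mul_right_comm _ (t (-a) ^ (s : ℤ)),
      mul_assoc _ (t (-a) ^ (s : ℤ)), mul_comm lam]
  · have e : LinkDiagram.Smoothing.joining (-y) (-y) = .oriented := if_pos rfl
    rw [e, if_neg (LinkDiagram.units_neg_ne_self y), mul_one, crossingWeight, crossingWeight,
      units_zpow_eq A]

/-- All type III moves require the same identities: flipping the orientation of a strand only moves
the color of a crossing across the third strand and replaces ratios by their reciprocals. The sides
of the strands on which the triangle lies are `σt`, `σm`, `σb`; the move changes all three. -/
theorem TriangleWeights.triangleIdentity {δ : R} {A₁ B₁ A₂ B₂ A₃ B₃ : ℤˣ → Rˣ}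
    (h : TriangleWeights δ A₁ B₁ A₂ B₂ A₃ B₃) (s σt σm σb : ℤˣ) :
    TriangleIdentity δ
      (crossingWeight (A₁ σb) (B₁ σb) s (.joining σt σm))
      (crossingWeight (A₁ σb) (B₁ σb) s (.joining σt (-σm)))
      (crossingWeight (A₂ σm) (B₂ σm) (-σb * σm * s) (.joining σt σb))
      (crossingWeight (A₂ σm) (B₂ σm) (-σb * σm * s) (.joining σt (-σb)))
      (crossingWeight (A₃ σt) (B₃ σt) (σb * σt * s) (.joining σm σb))
      (crossingWeight (A₃ σt) (B₃ σt) (σb * σt * s) (.joining σm (-σb)))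
      (crossingWeight (A₁ (-σb)) (B₁ (-σb)) s (.joining σt σm))
      (crossingWeight (A₁ (-σb)) (B₁ (-σb)) s (.joining σt (-σm)))
      (crossingWeight (A₂ (-σm)) (B₂ (-σm)) (-σb * σm * s) (.joining σt σb))
      (crossingWeight (A₂ (-σm)) (B₂ (-σm)) (-σb * σm * s) (.joining σt (-σb)))
      (crossingWeight (A₃ (-σt)) (B₃ (-σt)) (σb * σt * s) (.joining σm σb))
      (crossingWeight (A₃ (-σt)) (B₃ (-σt)) (σb * σt * s) (.joining σm (-σb))) := by
  obtain ⟨lam, t₁, t₂, t₃, hB₁, hB₂, hB₃, ht₁, ht₂, ht₃, hr⟩ := h.exists_ratios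
  have hlam : lam * lam = 1 := Units.ext (by simpa [sq] using hr.sq)
  have hlam' : lam⁻¹ = lam := inv_eq_of_mul_eq_one_left hlam
  -- The product of the coefficients of the states that cut off no corner changes by `lam`.
  have hy : crossingWeight (A₁ σb) (B₁ σb) s (.joining σt (-σm)) *
      crossingWeight (A₂ σm) (B₂ σm) (-σb * σm * s) (.joining σt (-σb)) *
      crossingWeight (A₃ σt) (B₃ σt) (σb * σt * s) (.joining σm (-σb)) =
      lam * (crossingWeight (A₁ (-σb)) (B₁ (-σb)) s (.joining σt (-σm)) *
      crossingWeight (A₂ (-σm)) (B₂ (-σm)) (-σb * σm * s) (.joining σt (-σb)) *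
      crossingWeight (A₃ (-σt)) (B₃ (-σt)) (σb * σt * s) (.joining σm (-σb))) := by
    have hA : (A₁ 1 * (A₁ (-1))⁻¹) ^ ((σb * s : ℤˣ) : ℤ) *
        (A₂ 1 * (A₂ (-1))⁻¹) ^ ((σm * (-σb * σm * s) : ℤˣ) : ℤ) *
        (A₃ 1 * (A₃ (-1))⁻¹) ^ ((σt * (σb * σt * s) : ℤˣ) : ℤ) = 1 := by
      have e₁ : σm * (-σb * σm * s) = -(σb * s) := by
        rcases Int.units_eq_one_or σm with rfl | rfl <;> simp
      have e₂ : σt * (σb * σt * s) = σb * s := by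
        rcases Int.units_eq_one_or σt with rfl | rfl <;> simp
      rw [e₁, e₂, Units.val_neg, zpow_neg, ← inv_zpow, ← mul_zpow, ← mul_zpow]
      have : A₁ 1 * (A₁ (-1))⁻¹ * (A₂ 1 * (A₂ (-1))⁻¹)⁻¹ * (A₃ 1 * (A₃ (-1))⁻¹) = 1 := by
        rw [← div_eq_mul_inv, ← div_eq_mul_inv, ← div_eq_mul_inv, ← div_eq_mul_inv, div_div_div_eq,
          div_mul_div_comm, div_eq_one]
        calc _ = A₃ 1 * A₁ 1 * A₂ (-1) := by ac_rfl
          _ = _ := h.three_AAA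
          _ = _ := by ac_rfl
      rw [this, one_zpow]
    have hl : ((if σt = σm then lam else 1) * if σt = σb then lam else 1) *
        (if σm = σb then lam else 1) = lam := by
      rcases Int.units_eq_one_or σt with rfl | rfl <;>
        rcases Int.units_eq_one_or σm with rfl | rfl <;>
        rcases Int.units_eq_one_or σb with rfl | rfl <;> simp [hlam]
    have collect : ∀ y₁ y₂ y₃ p₁ p₂ p₃ l₁ l₂ l₃ : Rˣ,
        y₁ * p₁ * l₁ * (y₂ * p₂ * l₂) * (y₃ * p₃ * l₃) =
        p₁ * p₂ * p₃ * (l₁ * l₂ * l₃ * (y₁ * y₂ * y₃)) := by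
      intros
      ac_rfl
    rw [crossingWeight_eq hB₁ ht₁ hlam σb, crossingWeight_eq hB₂ ht₂ hlam σm,
      crossingWeight_eq hB₃ ht₃ hlam σt, collect, hA, hl, one_mul]
  have hr₁ : ∀ a, TriangleRatios δ (lam : R) (t₁ a) ((t₂ (-1))⁻¹ : Rˣ) (t₃ 1) := by
    intro a
    rcases Int.units_eq_one_or a with rfl | rfl
    · exact hr
    · simpa [ht₁] using hr.scale
  have hr₂ : ∀ a b, TriangleRatios δ (lam : R) (t₁ a) ((t₂ b)⁻¹ : Rˣ) (t₃ 1) := by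
    intro a b
    rcases Int.units_eq_one_or b with rfl | rfl
    · have e : (t₂ 1)⁻¹ = lam * (t₂ (-1))⁻¹ := by
        rw [ht₂, mul_inv, hlam', ← mul_assoc, hlam, one_mul]
      rw [e]
      exact (hr₁ a).rotate.scale.rotate.rotate
    · exact hr₁ a
  have hr₃ : ∀ a b c, TriangleRatios δ (lam : R) (t₁ a) ((t₂ b)⁻¹ : Rˣ) (t₃ c) := by
    intro a b c
    rcases Int.units_eq_one_or c with rfl | rfl
    · exact hr₂ a b
    · simpa [ht₃] using (hr₂ a b).rotate.rotate.scale.rotate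
  have hr₄ : ∀ a b c n : ℤˣ, TriangleRatios δ (lam : R) (t₁ a ^ (n : ℤ) : Rˣ)
      (t₂ b ^ ((-n : ℤˣ) : ℤ) : Rˣ) (t₃ c ^ (n : ℤ) : Rˣ) := by
    intro a b c n
    rcases Int.units_eq_one_or n with rfl | rfl
    · simpa using hr₃ a b c
    · simpa using (hr₃ a b c).inv (Units.mul_inv _) (Units.inv_mul _) (Units.mul_inv _)
  have e₂ : -(σt * σb * (-σb * σm * s)) = -(-(σt * σm * s)) := by
    rcases Int.units_eq_one_or σb with rfl | rfl <;> simp [mul_assoc]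
  have e₃ : -(σm * σb * (σb * σt * s)) = -(σt * σm * s) := by
    rcases Int.units_eq_one_or σb with rfl | rfl <;> simp [mul_left_comm, mul_assoc]
  have hx := (hr₄ σb σm σt (-(σt * σm * s))).triangleIdentity
    (by simpa only [Units.val_mul] using congrArg Units.val hy)
  rw [crossingWeight_joining (hB₁ σb), crossingWeight_joining (hB₂ σm),
    crossingWeight_joining (hB₃ σt), crossingWeight_joining (hB₁ (-σb)),
    crossingWeight_joining (hB₂ (-σm)), crossingWeight_joining (hB₃ (-σt)), e₂, e₃,
    zpow_eq_lam_mul ht₁ hlam (-σb), zpow_eq_lam_mul ht₂ hlam (-σm),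
    zpow_eq_lam_mul ht₃ hlam (-σt), neg_neg σb, neg_neg σm, neg_neg σt]
  simpa only [Units.val_mul] using hx

end Weights

namespace LinkDiagram

/-! ### Colored moves that erase crossings -/

section Colorings

variable {X : Type*} [Biquandle X] {D D' : LinkDiagram}

/-- A coloring of the semiarcs satisfies the conditions at the crossing `c`. -/
def IsColoredAt (D : LinkDiagram) (f : D.Arc → X) (c : D.Crossing) : Prop :=
  IsFace (fun a => f (D.underEnd c a)) fun a => f (D.overEnd c a)

theorem isColoredAt_iff (f : D.Arc → X) (c : D.Crossing) : D.IsColoredAt f c ↔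
    f (D.rightUnder c) = Biquandle.underOp (f (D.leftUnder c)) (f (D.leftOver c)) ∧
      f (D.rightOver c) = Biquandle.overOp (f (D.leftOver c)) (f (D.leftUnder c)) := by
  rw [leftUnder_eq, leftOver_eq, rightUnder_eq, rightOver_eq]
  exact ⟨fun h => ⟨h.right_under, h.right_over⟩, fun h => ⟨h.1, h.2⟩⟩

theorem Coloring.isColoredAt (f : D.Coloring X) (c : D.Crossing) : D.IsColoredAt f.1 c :=
  (isColoredAt_iff f.1 c).2 (f.2 c)

/-- A coloring from the conditions at the crossings. -/
def Coloring.mk' (f : D.Arc → X) (h : ∀ c, D.IsColoredAt f c) : D.Coloring X :=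
  ⟨f, fun c => (isColoredAt_iff f c).1 (h c)⟩

theorem IsColoredAt.of_strandEnd_eq {f : D.Arc → X} {f' : D'.Arc → X} {c : D.Crossing}
    {c' : D'.Crossing} (h : D.IsColoredAt f c)
    (he : ∀ t a, f' (D'.strandEnd (c', t) a) = f (D.strandEnd (c, t) a)) :
    D'.IsColoredAt f' c' := by
  unfold IsColoredAt at h ⊢
  simpa only [he] using h

variable {R : Type*} [CommRing R]

theorem smoothingCoeff_eq (β : BiquandleBracket X R) (f : D.Coloring X) (c : D.Crossing)
    (t : Smoothing) : D.smoothingCoeff β f c t =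
      crossingWeight (β.A (f.1 (D.underEnd c 1)) (f.1 (D.overEnd c 1)))
        (β.B (f.1 (D.underEnd c 1)) (f.1 (D.overEnd c 1))) (D.sign c) t := by
  rw [← leftUnder_eq, ← leftOver_eq]
  cases t <;> rfl

theorem exists_joining (t : Smoothing) : ∃ a b, t = Smoothing.joining a b := by
  cases t
  · exact ⟨1, 1, rfl⟩
  · exact ⟨1, -1, rfl⟩

theorem isolated_smoothingSetoid {c : D.Crossing} {e : D.Arc}
    (h : ∀ t a, D.strandEnd (c, t) a ≠ e) (t : Smoothing) :
    Isolated (D.smoothingSetoid c t) e := by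
  obtain ⟨a, b, rfl⟩ := exists_joining t
  rw [smoothingSetoid_joining]
  exact (isolated_joinPair (h _ _) (h _ _)).sup (isolated_joinPair (h _ _) (h _ _))

theorem map_smoothingSetoid {π : D'.Arc → D.Arc} {c : D.Crossing} {c' : D'.Crossing}
    (he : ∀ t a, D.strandEnd (c, t) a = π (D'.strandEnd (c', t) a)) (t : Smoothing) :
    (D'.smoothingSetoid c' t).map π = D.smoothingSetoid c t := by
  obtain ⟨a, b, rfl⟩ := exists_joining t
  simp only [smoothingSetoid_joining, Setoid.map_sup, Setoid.map_joinPair, underEnd, overEnd, he]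

namespace IsErasure

variable {S : Set D'.Crossing} {κ : D.Crossing → D'.Crossing} {π : D'.Arc → D.Arc}

theorem strandEnd_eq (h : IsErasure D D' S κ π) (c : D.Crossing) (t : Strand) (a : ℤˣ) :
    D.strandEnd (c, t) a = π (D'.strandEnd (κ c, t) a) := by
  have hs : D.innSide (c, t) = D'.innSide (κ c, t) := by
    cases t <;> simp [innSide, h.sign_eq]
  unfold strandEnd
  rw [hs, h.inn_eq, h.out_eq]
  split_ifs <;> rfl

/-- The semiarcs become part of the same semiarc if the erased crossings are run through. -/
theorem ker_le_iff (h : IsErasure D D' S κ π) {Y : Setoid D'.Arc} : Setoid.ker π ≤ Y ↔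
    ∀ c ∈ S, ∀ t, ∀ a : ℤˣ, Y (D'.strandEnd (c, t) a) (D'.strandEnd (c, t) (-a)) := by
  have hk : Setoid.ker π = Relation.EqvGen.setoid
      (fun a b => ∃ c ∈ S, ∃ t, a = D'.inn (c, t) ∧ b = D'.out (c, t)) :=
    Setoid.ext fun a b => h.eq_iff a b
  rw [hk]
  constructor
  · intro hY c hc t a
    have e : Y (D'.inn (c, t)) (D'.out (c, t)) := hY (.rel _ _ ⟨c, hc, t, rfl, rfl⟩)
    rcases units_eq_or_eq_neg a (D'.innSide (c, t)) with rfl | rfl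
    · rwa [strandEnd_innSide, strandEnd_neg_innSide]
    · rw [neg_neg, strandEnd_innSide, strandEnd_neg_innSide]
      exact Setoid.symm' _ e
  · intro hY
    apply Setoid.eqvGen_le
    rintro _ _ ⟨c, hc, t, rfl, rfl⟩
    have := hY c hc t (D'.innSide (c, t))
    rwa [strandEnd_innSide, strandEnd_neg_innSide] at this

theorem ker_le_iff_forall_ends (h : IsErasure D D' S κ π) {Y : Setoid D'.Arc} (α γ : ℤˣ) :
    Setoid.ker π ≤ Y ↔ ∀ c ∈ S, Y (D'.overEnd c α) (D'.overEnd c (-α)) ∧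
      Y (D'.underEnd c γ) (D'.underEnd c (-γ)) := by
  rw [h.ker_le_iff]
  refine ⟨fun hY c hc => ⟨hY c hc _ _, hY c hc _ _⟩, fun hY c hc t a => ?_⟩
  obtain ⟨h₁, h₂⟩ := hY c hc
  cases t
  · rcases units_eq_or_eq_neg a α with rfl | rfl
    · exact h₁
    · rw [neg_neg]; exact Setoid.symm' _ h₁
  · rcases units_eq_or_eq_neg a γ with rfl | rfl
    · exact h₂
    · rw [neg_neg]; exact Setoid.symm' _ h₂

theorem mem_or_exists (h : IsErasure D D' S κ π) (c' : D'.Crossing) :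
    c' ∈ S ∨ ∃ c, κ c = c' := by
  by_cases hc : c' ∈ S
  · exact Or.inl hc
  · exact Or.inr (h.range_eq ▸ hc : c' ∈ Set.range κ)

theorem apply_notMem (h : IsErasure D D' S κ π) (c : D.Crossing) : κ c ∉ S := by
  have : κ c ∈ Set.range κ := ⟨c, rfl⟩
  rw [h.range_eq] at this
  exact this

variable {r : D.Arc → D'.Arc → Prop} {outside : D'.Arc → Prop}

/-- Colorings correspond to each other under an erasure if the colors outside the disc determine
those inside and take the same values on the ends of each strand through the disc. -/
theorem existsUnique_agree (h : IsErasure D D' S κ π)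
    (hr : ∀ a a', r a a' ↔ outside a' ∧ a = π a')
    (hout : ∀ c t a, outside (D'.strandEnd (κ c, t) a))
    (hπ : ∀ x, ∃ y, outside y ∧ π y = π x)
    (lift : ∀ g : D.Arc → X, ∃ f' : D'.Arc → X, (∀ a', outside a' → f' a' = g (π a')) ∧
      ∀ c ∈ S, D'.IsColoredAt f' c)
    (unique : ∀ f₁ f₂ : D'.Arc → X, (∀ a', outside a' → f₁ a' = f₂ a') →
      (∀ c ∈ S, D'.IsColoredAt f₁ c) → (∀ c ∈ S, D'.IsColoredAt f₂ c) → f₁ = f₂)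
    (descend : ∀ f' : D'.Arc → X, (∀ c ∈ S, D'.IsColoredAt f' c) →
      ∃ g : D'.Arc → X, Setoid.ker π ≤ Setoid.ker g ∧ ∀ a', outside a' → f' a' = g a') :
    (∀ f : D.Coloring X, ∃! f' : D'.Coloring X, Coloring.Agree r f f') ∧
      ∀ f' : D'.Coloring X, ∃! f : D.Coloring X, Coloring.Agree r f f' := by
  constructor
  · intro f
    obtain ⟨f', h₁, h₂⟩ := lift f.1
    refine ⟨Coloring.mk' f' fun c' => ?_, fun a a' haa' => ?_, fun f'' h'' => ?_⟩
    · rcases h.mem_or_exists c' with hc | ⟨c, rfl⟩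
      · exact h₂ c' hc
      · exact (f.isColoredAt c).of_strandEnd_eq fun t a => by
          rw [h₁ _ (hout c t a), h.strandEnd_eq]
    · obtain ⟨ho, rfl⟩ := (hr _ _).1 haa'
      exact (h₁ a' ho).symm
    · refine Subtype.ext (unique _ _ (fun a' ho => ?_) (fun c _ => f''.isColoredAt c) h₂)
      exact (h'' _ a' ((hr _ _).2 ⟨ho, rfl⟩)).symm.trans (h₁ a' ho).symm
  · intro f'
    obtain ⟨g, hg⟩ : ∃ g : D.Arc → X, ∀ a', outside a' → f'.1 a' = g (π a') := by
      obtain ⟨g', hk, hg'⟩ := descend f'.1 fun c _ => f'.isColoredAt c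
      refine ⟨fun a => g' (Function.surjInv h.surjective a), fun a' ho => (hg' a' ho).trans ?_⟩
      exact hk (Function.surjInv_eq h.surjective (π a')).symm
    refine ⟨Coloring.mk' g fun c => ?_, fun a a' haa' => ?_, fun f h' => Subtype.ext ?_⟩
    · exact (f'.isColoredAt (κ c)).of_strandEnd_eq fun t a => by
        rw [hg _ (hout c t a), h.strandEnd_eq]
    · obtain ⟨ho, rfl⟩ := (hr _ _).1 haa'
      exact (hg a' ho).symm
    · funext a
      obtain ⟨a', rfl⟩ := h.surjective a
      obtain ⟨y, ho, hy⟩ := hπ a'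
      rw [← hy]
      exact (h' _ y ((hr _ _).2 ⟨ho, rfl⟩)).trans (hg y ho)

/-- The state-sum value does not change under an erasure if the state sum of the erased tangle is
that of the strands that replace it, up to the power of `w` for its crossings. -/
theorem bracketValue_eq (h : IsErasure D D' S κ π) {I : Type} [Fintype I] (j : I → D'.Crossing)
    (hj : Function.Injective j) (hjS : Set.range j = S)
    (hr : ∀ a a', r a a' ↔ outside a' ∧ a = π a')
    (hout : ∀ c t a, outside (D'.strandEnd (κ c, t) a))
    (β : BiquandleBracket X R) (f : D.Coloring X) (f' : D'.Coloring X)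
    (hf : Coloring.Agree r f f')
    (hlocal : ∀ T : Setoid D'.Arc, (∀ x, ¬ outside x → Isolated T x) →
      stateSum β.δ T (fun i => D'.smoothingSetoid (j i))
        (fun i t => (D'.smoothingCoeff β f' (j i) t : R)) =
        ((β.w ^ (∑ i, (D'.sign (j i) : ℤ)) : Rˣ) : R) * β.δ ^ classCount (T ⊔ Setoid.ker π)) :
    D.bracketValue β f = D'.bracketValue β f' := by
  classical
  have hbij : Function.Bijective (Sum.elim κ j) := by
    constructor
    · refine h.injective.sumElim hj fun c i hci => h.apply_notMem c ?_
      rw [hci, ← hjS]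
      exact ⟨i, rfl⟩
    · intro c'
      rcases h.mem_or_exists c' with hc | ⟨c, rfl⟩
      · rw [← hjS] at hc
        obtain ⟨i, rfl⟩ := hc
        exact ⟨.inr i, rfl⟩
      · exact ⟨.inl c, rfl⟩
  let e : D.Crossing ⊕ I ≃ D'.Crossing := Equiv.ofBijective _ hbij
  have hcoeff : ∀ c t, D'.smoothingCoeff β f' (κ c) t = D.smoothingCoeff β f c t := by
    intro c t
    have he : ∀ t a, f'.1 (D'.strandEnd (κ c, t) a) = f.1 (D.strandEnd (c, t) a) := fun t a => by
      rw [h.strandEnd_eq]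
      exact (hf _ _ ((hr _ _).2 ⟨hout c t a, rfl⟩)).symm
    rw [smoothingCoeff_eq, smoothingCoeff_eq, he, he, h.sign_eq]
  have hwr : D'.negWrithe = D.negWrithe - ∑ i, (D'.sign (j i) : ℤ) := by
    rw [negWrithe_eq, negWrithe_eq, ← Equiv.sum_comp e, Fintype.sum_sum_type]
    simp only [e, Equiv.ofBijective_apply, Sum.elim_inl, Sum.elim_inr, h.sign_eq]
    ring
  have hsum : stateSum β.δ ⊥ D'.smoothingSetoid (fun c t => (D'.smoothingCoeff β f' c t : R)) =
      ((β.w ^ (∑ i, (D'.sign (j i) : ℤ)) : Rˣ) : R) *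
        stateSum β.δ ⊥ D.smoothingSetoid (fun c t => (D.smoothingCoeff β f c t : R)) := by
    rw [stateSum_eq_sum e, stateSum_eq, Finset.mul_sum]
    refine Finset.sum_congr rfl fun s _ => ?_
    simp only [e, Equiv.ofBijective_apply, Sum.elim_inl, Sum.elim_inr, hcoeff, bot_sup_eq]
    rw [hlocal, mul_left_comm, ← classCount_map h.surjective, Setoid.map_iSup]
    · simp only [map_smoothingSetoid (h.strandEnd_eq _)]
    · intro x hx
      exact isolated_iSup fun c => isolated_smoothingSetoid
        (fun t a hta => hx (by rw [← hta]; exact hout c t a)) _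
  rw [LinkDiagram.bracketValue_eq, LinkDiagram.bracketValue_eq, hsum, hwr, ← mul_assoc,
    ← Units.val_mul, ← zpow_add, sub_add_cancel]

end IsErasure

end Colorings
/-! ### Moves of types I and II -/

section KinkBigon

variable {X : Type*} [Biquandle X] {R : Type*} [CommRing R] {D D' : LinkDiagram}

/-- The three claims about colorings and values for two diagrams related by a move. -/
def ColoredInvariance (β : BiquandleBracket X R) (D D' : LinkDiagram)
    (r : D.Arc → D'.Arc → Prop) : Prop :=
  (∀ f : D.Coloring X, ∃! f' : D'.Coloring X, Coloring.Agree r f f') ∧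
    (∀ f' : D'.Coloring X, ∃! f : D.Coloring X, Coloring.Agree r f f') ∧
      ∀ (f : D.Coloring X) (f' : D'.Coloring X), Coloring.Agree r f f' →
        D.bracketValue β f = D'.bracketValue β f'

theorem kink_weight (β : BiquandleBracket X R) (x : X) (s : ℤˣ) :
    β.δ * (crossingWeight (β.A x x) (β.B x x) s .oriented : R) +
      (crossingWeight (β.A x x) (β.B x x) s .unoriented : R) = (β.w ^ (s : ℤ) : Rˣ) := by
  rcases Int.units_eq_one_or s with rfl | rfl
  · simpa [crossingWeight] using β.kink_pos x
  · simpa [crossingWeight] using β.kink_neg x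

theorem bigon_weight {δ : R} {A B : Rˣ}
    (h : δ = -((A : R) * (B⁻¹ : Rˣ)) - (A⁻¹ : Rˣ) * (B : R)) (s u v : ℤˣ) :
    δ * ((crossingWeight A B s (.joining u v) : R) * crossingWeight A B (-s) (.joining u v)) +
      (crossingWeight A B s (.joining u v) : R) * crossingWeight A B (-s) (.joining u (-v)) +
      (crossingWeight A B s (.joining u (-v)) : R) * crossingWeight A B (-s) (.joining u v) =
        0 := by
  have hA := A.mul_inv
  have hB := B.mul_inv
  have e : (Smoothing.joining u v = .oriented ∧ Smoothing.joining u (-v) = .unoriented) ∨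
      (Smoothing.joining u v = .unoriented ∧ Smoothing.joining u (-v) = .oriented) := by
    unfold Smoothing.joining
    rcases units_eq_or_eq_neg u v with rfl | rfl
    · exact Or.inl ⟨if_pos rfl, if_neg (units_neg_ne_self u).symm⟩
    · exact Or.inr ⟨if_neg (units_neg_ne_self v), if_pos rfl⟩
  rcases e with ⟨e₁, e₂⟩ | ⟨e₁, e₂⟩ <;> rcases Int.units_eq_one_or s with rfl | rfl <;>
    rw [e₁, e₂] <;> simp [crossingWeight] <;> rw [h] <;> ring

theorem crossingWeight_mul_neg (A B : Rˣ) (s : ℤˣ) (t : Smoothing) :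
    (crossingWeight A B s t : R) * crossingWeight A B (-s) t = 1 := by
  rw [← Units.val_mul]
  cases t <;> simp [crossingWeight]

variable {κ : D.Crossing → D'.Crossing} {π : D'.Arc → D.Arc} {r : D.Arc → D'.Arc → Prop}

/-- Type I moves: the loop `e` is the end of both strands at the side `α` of the crossing. -/
theorem coloredInvariance_kink [Finite X] (β : BiquandleBracket X R) {c : D'.Crossing}
    {α : ℤˣ} {e : D'.Arc}
    (hu : D'.underEnd c α = e) (ho : D'.overEnd c α = e) (h : IsErasure D D' {c} κ π)
    (hr : ∀ a a', r a a' ↔ a' ≠ e ∧ a = π a') : ColoredInvariance β D D' r := by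
  classical
  have ends : ∀ c' t a, D'.strandEnd (c', t) a = e → c' = c ∧ a = α := by
    intro c' t a ha
    rcases eq_or_eq_of_strandEnd_eq (hu.trans ho.symm) (by simp) (ha.trans hu.symm) with
      ⟨h₁, h₂⟩ | ⟨h₁, h₂⟩
    · exact ⟨congrArg Prod.fst h₁, h₂⟩
    · exact ⟨congrArg Prod.fst h₁, h₂⟩
  have hu' : D'.underEnd c (-α) ≠ e := fun he => units_neg_ne_self α (ends _ _ _ he).2
  have ho' : D'.overEnd c (-α) ≠ e := fun he => units_neg_ne_self α (ends _ _ _ he).2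
  have hout : ∀ c₀ t a, D'.strandEnd (κ c₀, t) a ≠ e := fun c₀ t a he =>
    h.apply_notMem c₀ (ends _ _ _ he).1
  have hπu : π (D'.underEnd c (-α)) = π e := by
    rw [← hu]; exact (h.ker_le_iff.1 le_rfl c rfl .lower α).symm
  have hπo : π (D'.overEnd c (-α)) = π e := by
    rw [← ho]; exact (h.ker_le_iff.1 le_rfl c rfl .upper α).symm
  have same : ∀ f' : D'.Arc → X, D'.IsColoredAt f' c →
      (fun a => f' (D'.underEnd c a)) = fun a => f' (D'.overEnd c a) := fun f' hf' =>
    IsFace.eq_of_eq hf' (a := α) (by rw [hu, ho])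
  have hcol : _ ∧ _ := h.existsUnique_agree (X := X) hr hout ?_ ?_ ?_ ?_
  · refine ⟨hcol.1, hcol.2, fun f f' hf => ?_⟩
    refine h.bracketValue_eq (fun _ : Unit => c) (fun _ _ _ => rfl) (by simp) hr hout β f f' hf ?_
    intro T hT
    have hk := stateSum_kink (hT e (not_not.2 rfl)) hu' ho' (J := D'.smoothingSetoid c)
      (by have := smoothingSetoid_joining c α α
          rwa [Smoothing.joining, if_pos rfl, hu, ho] at this)
      (by have := smoothingSetoid_joining c α (-α)
          rwa [Smoothing.joining, if_neg (units_neg_ne_self α).symm, neg_neg, hu, ho] at this)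
      (fun t => (D'.smoothingCoeff β f' c t : R)) β.δ
    have hx : f'.1 (D'.underEnd c 1) = f'.1 (D'.overEnd c 1) :=
      congrFun (same f'.1 (f'.isColoredAt c)) 1
    have hT' : T ⊔ (joinPair (D'.underEnd c (-α)) e ⊔ joinPair e (D'.overEnd c (-α))) =
        T ⊔ Setoid.ker π := eq_of_forall_ge_iff fun Y => by
      simp only [sup_le_iff, h.ker_le_iff_forall_ends α α, joinPair_le, Set.mem_singleton_iff,
        forall_eq, hu, ho]
      rw [Setoid.comm' Y (x := e) (y := D'.underEnd c (-α)),
        and_comm (a := Y (D'.underEnd c (-α)) e)]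
    rw [hk, hT', smoothingCoeff_eq, smoothingCoeff_eq, hx, kink_weight]
    simp
  · intro x
    by_cases hx : x = e
    · exact ⟨_, hu', by rw [hπu, hx]⟩
    · exact ⟨x, hx, rfl⟩
  · intro g
    obtain ⟨u, huu, hug⟩ := exists_isFace_self (-α) (g (π e))
    refine ⟨fun x => if x = e then u α else g (π x), fun a' ha' => if_neg ha', ?_⟩
    intro c' hc'
    obtain rfl : c = c' := hc'.symm
    have h₁ : (fun a => if D'.underEnd c a = e then u α else g (π (D'.underEnd c a))) = u :=
      units_funext_of α (by simp [hu]) (by rw [if_neg hu', hπu, hug])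
    have h₂ : (fun a => if D'.overEnd c a = e then u α else g (π (D'.overEnd c a))) = u :=
      units_funext_of α (by simp [ho]) (by rw [if_neg ho', hπo, hug])
    unfold IsColoredAt
    rwa [h₁, h₂]
  · intro f₁ f₂ h₁₂ h₁ h₂
    obtain ⟨e₁, -⟩ := IsFace.ext (h₁ c rfl) (h₂ c rfl) (-α) (-α) (h₁₂ _ hu') (h₁₂ _ ho')
    funext x
    by_cases hx : x = e
    · rw [hx, ← hu]; exact congrFun e₁ α
    · exact h₁₂ x hx
  · intro f' hf'
    have hs := congrFun (same f' (hf' c rfl)) (-α)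
    refine ⟨fun x => if x = e then f' (D'.underEnd c (-α)) else f' x, ?_,
      fun a' ha' => (if_neg ha').symm⟩
    rw [h.ker_le_iff_forall_ends α α]
    intro c' hc'
    obtain rfl : c = c' := hc'.symm
    rw [Setoid.ker_def, Setoid.ker_def, hu, ho, if_pos rfl, if_neg ho', if_neg hu']
    exact ⟨hs, rfl⟩

/-- Type II moves: the two crossings share the end `e` of the over-strand at their sides `α` and
the end `g` of the under-strand at their sides `γ`. -/
theorem coloredInvariance_bigon (β : BiquandleBracket X R) {c₁ c₂ : D'.Crossing} {α γ : ℤˣ}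
    {e g : D'.Arc} (hs : D'.sign c₂ = -D'.sign c₁)
    (he₁ : D'.overEnd c₁ α = e) (he₂ : D'.overEnd c₂ α = e)
    (hg₁ : D'.underEnd c₁ γ = g) (hg₂ : D'.underEnd c₂ γ = g)
    (h : IsErasure D D' {c₁, c₂} κ π)
    (hr : ∀ a a', r a a' ↔ (a' ≠ e ∧ a' ≠ g) ∧ a = π a') : ColoredInvariance β D D' r := by
  classical
  have hne : c₁ ≠ c₂ := by
    rintro rfl
    exact units_neg_ne_self _ hs.symm
  have endsE : ∀ c t a, D'.strandEnd (c, t) a = e → (c = c₁ ∨ c = c₂) ∧ t = .upper ∧ a = α := by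
    intro c t a ha
    rcases eq_or_eq_of_strandEnd_eq (he₁.trans he₂.symm) (by simp [hne]) (ha.trans he₁.symm) with
      ⟨h₁, h₂⟩ | ⟨h₁, h₂⟩ <;> rw [Prod.mk.injEq] at h₁
    · exact ⟨Or.inl h₁.1, h₁.2, h₂⟩
    · exact ⟨Or.inr h₁.1, h₁.2, h₂⟩
  have endsG : ∀ c t a, D'.strandEnd (c, t) a = g → (c = c₁ ∨ c = c₂) ∧ t = .lower ∧ a = γ := by
    intro c t a ha
    rcases eq_or_eq_of_strandEnd_eq (hg₁.trans hg₂.symm) (by simp [hne]) (ha.trans hg₁.symm) with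
      ⟨h₁, h₂⟩ | ⟨h₁, h₂⟩ <;> rw [Prod.mk.injEq] at h₁
    · exact ⟨Or.inl h₁.1, h₁.2, h₂⟩
    · exact ⟨Or.inr h₁.1, h₁.2, h₂⟩
  have heg : e ≠ g := fun heg => by
    have := (endsG c₁ .upper α (he₁.trans heg)).2.1
    cases this
  have hover : ∀ c, D'.overEnd c (-α) ≠ e ∧ D'.overEnd c (-α) ≠ g := fun c =>
    ⟨fun hc => units_neg_ne_self α (endsE _ _ _ hc).2.2, fun hc => by
      have := (endsG _ _ _ hc).2.1
      cases this⟩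
  have hunder : ∀ c, D'.underEnd c (-γ) ≠ e ∧ D'.underEnd c (-γ) ≠ g := fun c =>
    ⟨fun hc => by
      have := (endsE _ _ _ hc).2.1
      contradiction, fun hc => units_neg_ne_self γ (endsG _ _ _ hc).2.2⟩
  have hE : ∀ c ∈ ({c₁, c₂} : Set D'.Crossing), D'.overEnd c α = e := by
    rintro c (rfl | rfl) <;> assumption
  have hG : ∀ c ∈ ({c₁, c₂} : Set D'.Crossing), D'.underEnd c γ = g := by
    rintro c (rfl | rfl) <;> assumption
  have m₁ : c₁ ∈ ({c₁, c₂} : Set D'.Crossing) := Or.inl rfl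
  have m₂ : c₂ ∈ ({c₁, c₂} : Set D'.Crossing) := Or.inr rfl
  have hout : ∀ c₀ t a, D'.strandEnd (κ c₀, t) a ≠ e ∧ D'.strandEnd (κ c₀, t) a ≠ g :=
    fun c₀ t a => ⟨fun hc => h.apply_notMem c₀ (endsE _ _ _ hc).1,
      fun hc => h.apply_notMem c₀ (endsG _ _ _ hc).1⟩
  have hπo : ∀ c ∈ ({c₁, c₂} : Set D'.Crossing), π (D'.overEnd c (-α)) = π e := fun c hc => by
    rw [← hE c hc]; exact (h.ker_le_iff.1 le_rfl c hc .upper α).symm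
  have hπu : ∀ c ∈ ({c₁, c₂} : Set D'.Crossing), π (D'.underEnd c (-γ)) = π g := fun c hc => by
    rw [← hG c hc]; exact (h.ker_le_iff.1 le_rfl c hc .lower γ).symm
  have same : ∀ f' : D'.Arc → X, D'.IsColoredAt f' c₁ → D'.IsColoredAt f' c₂ →
      (fun a => f' (D'.underEnd c₁ a)) = (fun a => f' (D'.underEnd c₂ a)) ∧
        (fun a => f' (D'.overEnd c₁ a)) = fun a => f' (D'.overEnd c₂ a) := fun f' h₁ h₂ =>
    IsFace.ext h₁ h₂ γ α (by rw [hg₁, hg₂]) (by rw [he₁, he₂])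
  have hcol : _ ∧ _ := h.existsUnique_agree (X := X) hr hout ?_ ?_ ?_ ?_
  · refine ⟨hcol.1, hcol.2, fun f f' hf => ?_⟩
    refine h.bracketValue_eq ![c₁, c₂] ?_ (by simp [Set.pair_comm]) hr hout β f f' hf ?_
    · intro i j hij
      fin_cases i <;> fin_cases j <;> simp [hne, hne.symm] at hij ⊢
    intro T hT
    obtain ⟨e₁, e₂⟩ := same f'.1 (f'.isColoredAt c₁) (f'.isColoredAt c₂)
    have hk : ∀ t, D'.smoothingCoeff β f' c₂ t =
        crossingWeight (β.A (f'.1 (D'.underEnd c₁ 1)) (f'.1 (D'.overEnd c₁ 1)))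
          (β.B (f'.1 (D'.underEnd c₁ 1)) (f'.1 (D'.overEnd c₁ 1))) (-D'.sign c₁) t := fun t => by
      rw [smoothingCoeff_eq, ← congrFun e₁ 1, ← congrFun e₂ 1, hs]
    have hb := stateSum_bigon (hT e fun hx => hx.1 rfl) (hT g fun hx => hx.2 rfl) heg
      (hover c₁).1 (hover c₂).1 (hunder c₁).1 (hunder c₂).1 (hover c₁).2 (hover c₂).2
      (hunder c₁).2 (hunder c₂).2 (J := fun i => D'.smoothingSetoid (![c₁, c₂] i))
      (u := γ) (v := α)
      (by have := smoothingSetoid_joining c₁ γ α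
          rwa [he₁, hg₁] at this)
      (by have := smoothingSetoid_joining c₁ γ (-α)
          rwa [neg_neg, he₁, hg₁] at this)
      (by have := smoothingSetoid_joining c₂ γ α
          rwa [he₂, hg₂] at this)
      (by have := smoothingSetoid_joining c₂ γ (-α)
          rwa [neg_neg, he₂, hg₂] at this)
      (fun i t => (D'.smoothingCoeff β f' (![c₁, c₂] i) t : R)) β.δ
      (by simp only [Matrix.cons_val_zero, Matrix.cons_val_one]
          rw [hk, smoothingCoeff_eq]
          exact crossingWeight_mul_neg _ _ _ _)
      (by simp only [Matrix.cons_val_zero, Matrix.cons_val_one, hk]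
          rw [smoothingCoeff_eq, smoothingCoeff_eq]
          exact bigon_weight (β.loop _ _) _ _ _)
    have hT' : T ⊔ (joinPair (D'.overEnd c₁ (-α)) e ⊔ joinPair e (D'.overEnd c₂ (-α)) ⊔
        (joinPair (D'.underEnd c₁ (-γ)) g ⊔ joinPair g (D'.underEnd c₂ (-γ)))) =
        T ⊔ Setoid.ker π := eq_of_forall_ge_iff fun Y => by
      simp only [sup_le_iff, h.ker_le_iff_forall_ends α γ, joinPair_le, Set.mem_insert_iff,
        Set.mem_singleton_iff, forall_eq_or_imp, forall_eq, he₁, he₂, hg₁, hg₂]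
      rw [Setoid.comm' Y (x := e) (y := D'.overEnd c₁ (-α)),
        Setoid.comm' Y (x := g) (y := D'.underEnd c₁ (-γ))]
      tauto
    rw [hb, hT', Fin.sum_univ_two]
    simp [hs]
  · intro x
    by_cases hx : x = e
    · exact ⟨_, hover c₁, by rw [hπo c₁ m₁, hx]⟩
    · by_cases hx' : x = g
      · exact ⟨_, hunder c₁, by rw [hπu c₁ m₁, hx']⟩
      · exact ⟨x, ⟨hx, hx'⟩, rfl⟩
  · intro k
    obtain ⟨u, o, huo, hu, ho⟩ := exists_isFace (-γ) (-α) (k (π g)) (k (π e))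
    refine ⟨fun x => if x = e then o α else if x = g then u γ else k (π x),
      fun a' ha' => by simp only; rw [if_neg ha'.1, if_neg ha'.2], ?_⟩
    intro c hc
    unfold IsColoredAt
    convert huo using 1
    · refine units_funext_of γ ?_ ?_
      · simp only; rw [hG c hc, if_neg heg.symm, if_pos rfl]
      · simp only; rw [if_neg (hunder c).1, if_neg (hunder c).2, hπu c hc, hu]
    · refine units_funext_of α ?_ ?_
      · simp only; rw [hE c hc, if_pos rfl]
      · simp only; rw [if_neg (hover c).1, if_neg (hover c).2, hπo c hc, ho]
  · intro f₁ f₂ h₁₂ h₁ h₂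
    obtain ⟨e₁, e₂⟩ := IsFace.ext (h₁ c₁ m₁) (h₂ c₁ m₁) (-γ) (-α) (h₁₂ _ (hunder c₁))
      (h₁₂ _ (hover c₁))
    funext x
    by_cases hx : x = e
    · rw [hx, ← he₁]; exact congrFun e₂ α
    · by_cases hx' : x = g
      · rw [hx', ← hg₁]; exact congrFun e₁ γ
      · exact h₁₂ x ⟨hx, hx'⟩
  · intro f' hf'
    obtain ⟨e₁, e₂⟩ := same f' (hf' c₁ m₁) (hf' c₂ m₂)
    have k₁ : ∀ c ∈ ({c₁, c₂} : Set D'.Crossing),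
        f' (D'.overEnd c (-α)) = f' (D'.overEnd c₁ (-α)) := by
      rintro c (rfl | rfl)
      exacts [rfl, (congrFun e₂ (-α)).symm]
    have k₂ : ∀ c ∈ ({c₁, c₂} : Set D'.Crossing),
        f' (D'.underEnd c (-γ)) = f' (D'.underEnd c₁ (-γ)) := by
      rintro c (rfl | rfl)
      exacts [rfl, (congrFun e₁ (-γ)).symm]
    refine ⟨fun x => if x = e then f' (D'.overEnd c₁ (-α)) else
      if x = g then f' (D'.underEnd c₁ (-γ)) else f' x, ?_,
      fun a' ha' => by simp only; rw [if_neg ha'.1, if_neg ha'.2]⟩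
    rw [h.ker_le_iff_forall_ends α γ]
    intro c hc
    rw [Setoid.ker_def, Setoid.ker_def, hE c hc, hG c hc, if_pos rfl, if_neg heg.symm, if_pos rfl,
      if_neg (hover c).1, if_neg (hover c).2, if_neg (hunder c).1, if_neg (hunder c).2]
    exact ⟨(k₁ c hc).symm, (k₂ c hc).symm⟩

end KinkBigon
/-! ### Moves of type III -/

section Triangle

variable {X : Type*} [Biquandle X] {R : Type*} [CommRing R] {D D' : LinkDiagram}

/-- The crossings `tm` (top and middle strand), `tb` (top and bottom) and `mb` (middle and bottom)
bound a triangle with sides `e₁`, `e₂`, `e₃` on the top, middle and bottom strand, which lies on the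
sides `σt`, `σm`, `σb` of the three strands. -/
structure IsTriangle (D : LinkDiagram) (tm tb mb : D.Crossing) (σt σm σb : ℤˣ)
    (e₁ e₂ e₃ : D.Arc) : Prop where
  tm_ne_tb : tm ≠ tb
  tm_ne_mb : tm ≠ mb
  tb_ne_mb : tb ≠ mb
  sign_tb : D.sign tb = -σb * σm * D.sign tm
  sign_mb : D.sign mb = σb * σt * D.sign tm
  over_tm : D.overEnd tm σm = e₁
  over_tb : D.overEnd tb σb = e₁
  under_tm : D.underEnd tm σt = e₂
  over_mb : D.overEnd mb σb = e₂
  under_tb : D.underEnd tb σt = e₃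
  under_mb : D.underEnd mb σm = e₃

namespace IsTriangle

variable {tm tb mb : D.Crossing} {σt σm σb : ℤˣ} {e₁ e₂ e₃ : D.Arc}

/-- Every end of a strand lies outside the triangle, with six exceptions. -/
theorem outside (h : IsTriangle D tm tb mb σt σm σb e₁ e₂ e₃) (c : D.Crossing) (t : Strand) (a : ℤˣ)
    (htm : c = tm → (t = .upper → a ≠ σm) ∧ (t = .lower → a ≠ σt))
    (htb : c = tb → (t = .upper → a ≠ σb) ∧ (t = .lower → a ≠ σt))
    (hmb : c = mb → (t = .upper → a ≠ σb) ∧ (t = .lower → a ≠ σm)) :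
    D.strandEnd (c, t) a ≠ e₁ ∧ D.strandEnd (c, t) a ≠ e₂ ∧ D.strandEnd (c, t) a ≠ e₃ := by
  refine ⟨fun he => ?_, fun he => ?_, fun he => ?_⟩
  · rcases eq_or_eq_of_strandEnd_eq (h.over_tm.trans h.over_tb.symm) (by simp [h.tm_ne_tb])
      (he.trans h.over_tm.symm) with ⟨h₁, h₂⟩ | ⟨h₁, h₂⟩ <;> rw [Prod.mk.injEq] at h₁
    · exact (htm h₁.1).1 h₁.2 h₂
    · exact (htb h₁.1).1 h₁.2 h₂
  · rcases eq_or_eq_of_strandEnd_eq (h.under_tm.trans h.over_mb.symm) (by simp)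
      (he.trans h.under_tm.symm) with ⟨h₁, h₂⟩ | ⟨h₁, h₂⟩ <;> rw [Prod.mk.injEq] at h₁
    · exact (htm h₁.1).2 h₁.2 h₂
    · exact (hmb h₁.1).1 h₁.2 h₂
  · rcases eq_or_eq_of_strandEnd_eq (h.under_tb.trans h.under_mb.symm) (by simp [h.tb_ne_mb])
      (he.trans h.under_tb.symm) with ⟨h₁, h₂⟩ | ⟨h₁, h₂⟩ <;> rw [Prod.mk.injEq] at h₁
    · exact (htb h₁.1).2 h₁.2 h₂
    · exact (hmb h₁.1).2 h₁.2 h₂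

theorem outside_of_ne (h : IsTriangle D tm tb mb σt σm σb e₁ e₂ e₃) {c : D.Crossing}
    (h₁ : c ≠ tm) (h₂ : c ≠ tb) (h₃ : c ≠ mb) (t : Strand) (a : ℤˣ) :
    D.strandEnd (c, t) a ≠ e₁ ∧ D.strandEnd (c, t) a ≠ e₂ ∧ D.strandEnd (c, t) a ≠ e₃ :=
  h.outside c t a (fun e => absurd e h₁) (fun e => absurd e h₂) (fun e => absurd e h₃)

theorem outside_over_tm (h : IsTriangle D tm tb mb σt σm σb e₁ e₂ e₃) :
    D.overEnd tm (-σm) ≠ e₁ ∧ D.overEnd tm (-σm) ≠ e₂ ∧ D.overEnd tm (-σm) ≠ e₃ :=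
  h.outside _ _ _ (by simp) (by simp [h.tm_ne_tb]) (by simp [h.tm_ne_mb])

theorem outside_under_tm (h : IsTriangle D tm tb mb σt σm σb e₁ e₂ e₃) :
    D.underEnd tm (-σt) ≠ e₁ ∧ D.underEnd tm (-σt) ≠ e₂ ∧ D.underEnd tm (-σt) ≠ e₃ :=
  h.outside _ _ _ (by simp) (by simp [h.tm_ne_tb]) (by simp [h.tm_ne_mb])

theorem outside_over_tb (h : IsTriangle D tm tb mb σt σm σb e₁ e₂ e₃) :
    D.overEnd tb (-σb) ≠ e₁ ∧ D.overEnd tb (-σb) ≠ e₂ ∧ D.overEnd tb (-σb) ≠ e₃ :=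
  h.outside _ _ _ (by simp [h.tm_ne_tb.symm]) (by simp) (by simp [h.tb_ne_mb])

theorem outside_under_tb (h : IsTriangle D tm tb mb σt σm σb e₁ e₂ e₃) :
    D.underEnd tb (-σt) ≠ e₁ ∧ D.underEnd tb (-σt) ≠ e₂ ∧ D.underEnd tb (-σt) ≠ e₃ :=
  h.outside _ _ _ (by simp [h.tm_ne_tb.symm]) (by simp) (by simp [h.tb_ne_mb])

theorem outside_over_mb (h : IsTriangle D tm tb mb σt σm σb e₁ e₂ e₃) :
    D.overEnd mb (-σb) ≠ e₁ ∧ D.overEnd mb (-σb) ≠ e₂ ∧ D.overEnd mb (-σb) ≠ e₃ :=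
  h.outside _ _ _ (by simp [h.tm_ne_mb.symm]) (by simp [h.tb_ne_mb.symm])
    (by simp)

theorem outside_under_mb (h : IsTriangle D tm tb mb σt σm σb e₁ e₂ e₃) :
    D.underEnd mb (-σm) ≠ e₁ ∧ D.underEnd mb (-σm) ≠ e₂ ∧ D.underEnd mb (-σm) ≠ e₃ :=
  h.outside _ _ _ (by simp [h.tm_ne_mb.symm]) (by simp [h.tb_ne_mb.symm])
    (by simp)

theorem sides_ne (h : IsTriangle D tm tb mb σt σm σb e₁ e₂ e₃) : e₁ ≠ e₂ ∧ e₁ ≠ e₃ ∧ e₂ ≠ e₃ := by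
  refine ⟨fun he => ?_, fun he => ?_, fun he => ?_⟩
  · rcases eq_or_eq_of_strandEnd_eq (h.under_tm.trans h.over_mb.symm) (by simp)
      ((h.over_tb.trans he).trans h.under_tm.symm) with ⟨h₁, -⟩ | ⟨h₁, -⟩ <;>
      simp [h.tb_ne_mb] at h₁
  · rcases eq_or_eq_of_strandEnd_eq (h.under_tb.trans h.under_mb.symm) (by simp [h.tb_ne_mb])
      ((h.over_tb.trans he).trans h.under_tb.symm) with ⟨h₁, -⟩ | ⟨h₁, -⟩ <;> simp at h₁
  · rcases eq_or_eq_of_strandEnd_eq (h.under_tb.trans h.under_mb.symm) (by simp [h.tb_ne_mb])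
      ((h.over_mb.trans he).trans h.under_tb.symm) with ⟨h₁, -⟩ | ⟨h₁, -⟩ <;> simp at h₁

/-- The colors of the semiarcs at the triangle are part of the coloring of a cube. -/
structure FitsCube (D : LinkDiagram) (f : D.Arc → X) (tm tb mb : D.Crossing) (σt σm σb : ℤˣ)
    (T M B : ℤˣ → ℤˣ → X) : Prop where
  over_tm : (fun m => f (D.overEnd tm m)) = fun m => T m σb
  under_tm : (fun t => f (D.underEnd tm t)) = fun t => M t σb
  over_tb : (fun b => f (D.overEnd tb b)) = fun b => T σm b
  under_tb : (fun t => f (D.underEnd tb t)) = fun t => B t σm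
  over_mb : (fun b => f (D.overEnd mb b)) = fun b => M σt b
  under_mb : (fun m => f (D.underEnd mb m)) = fun m => B σt m

theorem exists_fitsCube [Finite X] (h : IsTriangle D tm tb mb σt σm σb e₁ e₂ e₃)
    (f : D.Coloring X) :
    ∃ T M B : ℤˣ → ℤˣ → X, IsCube T M B ∧ FitsCube D f.1 tm tb mb σt σm σb T M B := by
  obtain ⟨T, M, B, hc, hT, hM, hB⟩ := exists_isCube σt σm σb (f.1 e₃) (f.1 e₂) (f.1 e₁)
  obtain ⟨a₁, a₂⟩ := IsFace.ext (f.isColoredAt tm) (hc.top_middle σb) σt σm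
    (by rw [h.under_tm, hM]) (by rw [h.over_tm, hT])
  obtain ⟨b₁, b₂⟩ := IsFace.ext (f.isColoredAt tb) (hc.top_bottom σm) σt σb
    (by rw [h.under_tb, hB]) (by rw [h.over_tb, hT])
  obtain ⟨c₁, c₂⟩ := IsFace.ext (f.isColoredAt mb) (hc.middle_bottom σt) σm σb
    (by rw [h.under_mb, hB]) (by rw [h.over_mb, hM])
  exact ⟨T, M, B, hc, a₂, a₁, b₂, b₁, c₂, c₁⟩

/-- The coefficient of a state at the triangle, at `tm` in the smoothing that joins the sides `a`
and `b`, in terms of a cube. -/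
theorem FitsCube.smoothingCoeff {β : BiquandleBracket X R} {f : D.Coloring X}
    {T M B : ℤˣ → ℤˣ → X} (hf : FitsCube D f.1 tm tb mb σt σm σb T M B) (t : Smoothing) :
    D.smoothingCoeff β f tm t =
        crossingWeight (β.A (M 1 σb) (T 1 σb)) (β.B (M 1 σb) (T 1 σb)) (D.sign tm) t ∧
      D.smoothingCoeff β f tb t =
        crossingWeight (β.A (B 1 σm) (T σm 1)) (β.B (B 1 σm) (T σm 1)) (D.sign tb) t ∧
      D.smoothingCoeff β f mb t =
        crossingWeight (β.A (B σt 1) (M σt 1)) (β.B (B σt 1) (M σt 1)) (D.sign mb) t := by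
  have a₁ := congrFun hf.over_tm 1
  have a₂ := congrFun hf.under_tm 1
  have a₃ := congrFun hf.over_tb 1
  have a₄ := congrFun hf.under_tb 1
  have a₅ := congrFun hf.over_mb 1
  have a₆ := congrFun hf.under_mb 1
  refine ⟨?_, ?_, ?_⟩
  · rw [smoothingCoeff_eq, a₁, a₂]
  · rw [smoothingCoeff_eq, a₃, a₄]
  · rw [smoothingCoeff_eq, a₅, a₆]

theorem stateSum_eq (h : IsTriangle D tm tb mb σt σm σb e₁ e₂ e₃) {S : Setoid D.Arc}
    (h₁ : Isolated S e₁) (h₂ : Isolated S e₂) (h₃ : Isolated S e₃) (δ : R)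
    (k : D.Crossing → Smoothing → R) {x₁ y₁ x₂ y₂ x₃ y₃ : R}
    (hx₁ : k tm (.joining σt σm) = x₁) (hy₁ : k tm (.joining σt (-σm)) = y₁)
    (hx₂ : k tb (.joining σt σb) = x₂) (hy₂ : k tb (.joining σt (-σb)) = y₂)
    (hx₃ : k mb (.joining σm σb) = x₃) (hy₃ : k mb (.joining σm (-σb)) = y₃) :
    stateSum δ S (fun i => D.smoothingSetoid (![tm, tb, mb] i)) (fun i => k (![tm, tb, mb] i)) =
      (δ * (x₁ * x₂ * x₃) + x₁ * x₂ * y₃ + x₁ * y₂ * x₃ + y₁ * x₂ * x₃) *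
          δ ^ matchingCount S (D.underEnd tm (-σt)) (D.overEnd tm (-σm)) (D.underEnd tb (-σt))
            (D.overEnd tb (-σb)) (D.underEnd mb (-σm)) (D.overEnd mb (-σb)) +
        x₁ * y₂ * y₃ * δ ^ matchingCount S (D.underEnd tm (-σt)) (D.overEnd tm (-σm))
          (D.overEnd tb (-σb)) (D.overEnd mb (-σb)) (D.underEnd tb (-σt)) (D.underEnd mb (-σm)) +
        y₁ * x₂ * y₃ * δ ^ matchingCount S (D.underEnd tb (-σt)) (D.overEnd tb (-σb))
          (D.overEnd tm (-σm)) (D.underEnd mb (-σm)) (D.underEnd tm (-σt)) (D.overEnd mb (-σb)) +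
        y₁ * y₂ * x₃ * δ ^ matchingCount S (D.underEnd mb (-σm)) (D.overEnd mb (-σb))
          (D.overEnd tm (-σm)) (D.overEnd tb (-σb)) (D.underEnd tm (-σt)) (D.underEnd tb (-σt)) +
        y₁ * y₂ * y₃ * δ ^ matchingCount S (D.overEnd tm (-σm)) (D.underEnd mb (-σm))
          (D.underEnd tm (-σt)) (D.underEnd tb (-σt)) (D.overEnd tb (-σb)) (D.overEnd mb (-σb)) :=
    by
  obtain ⟨h₁₂, h₁₃, h₂₃⟩ := h.sides_ne
  have j : ∀ c a b, D.smoothingSetoid c (.joining a (-b)) =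
      joinPair (D.underEnd c a) (D.overEnd c (-b)) ⊔
        joinPair (D.underEnd c (-a)) (D.overEnd c b) := fun c a b => by
    rw [smoothingSetoid_joining, neg_neg]
  refine stateSum_triangle h₁ h₂ h₃ h₁₂ h₁₃ h₂₃ h.outside_over_tm h.outside_under_tm
    h.outside_over_tb h.outside_under_tb h.outside_over_mb h.outside_under_mb
    (σt := σt) (σm := σm) (σb := σb) ?_ ?_ ?_ ?_ ?_ ?_ hx₁ hy₁ hx₂ hy₂ hx₃ hy₃
  · exact (smoothingSetoid_joining tm σt σm).trans (by rw [h.under_tm, h.over_tm])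
  · exact (j tm σt σm).trans (by rw [h.under_tm, h.over_tm])
  · exact (smoothingSetoid_joining tb σt σb).trans (by rw [h.under_tb, h.over_tb])
  · exact (j tb σt σb).trans (by rw [h.under_tb, h.over_tb])
  · exact (smoothingSetoid_joining mb σm σb).trans (by rw [h.under_mb, h.over_mb])
  · exact (j mb σm σb).trans (by rw [h.under_mb, h.over_mb])

end IsTriangle

/-- The bracket equations for three strands in the colors of a cube. -/
theorem triangleWeights_of_isCube (β : BiquandleBracket X R) {T M B : ℤˣ → ℤˣ → X}
    (h : IsCube T M B) :
    TriangleWeights β.δ (fun b => β.A (M 1 b) (T 1 b)) (fun b => β.B (M 1 b) (T 1 b))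
      (fun m => β.A (B 1 m) (T m 1)) (fun m => β.B (B 1 m) (T m 1))
      (fun t => β.A (B t 1) (M t 1)) (fun t => β.B (B t 1) (M t 1)) := by
  have a₁ := (h.top_middle 1).right_under
  have a₂ := (h.top_middle 1).right_over
  have a₃ := (h.top_bottom 1).right_under
  have a₄ := (h.top_bottom 1).right_over
  have a₅ := (h.middle_bottom 1).right_under
  have a₆ := (h.middle_bottom 1).right_over
  constructor
  · exact fun _ => β.loop _ _
  · exact fun _ => β.loop _ _
  · exact fun _ => β.loop _ _
  all_goals rw [a₁, a₂, a₃, a₄, a₅, a₆]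
  · exact β.three_AAA _ _ _
  · exact β.three_ABB _ _ _
  · exact β.three_BAB _ _ _
  · exact β.three_AAB _ _ _
  · exact β.three_BAA _ _ _

end Triangle
section TriangleMove

variable {X : Type*} [Biquandle X] {R : Type*} [CommRing R] {D D' : LinkDiagram}

/-- Up to renamings `κ` and `ι`, the diagram `D'` arises from `D` by moving the three strands at a
triangle past each other: each outer end becomes an end at the other crossing of its strand. The
conditions are symmetric in `D` and `D'`. -/
structure IsTriangleMove (D D' : LinkDiagram) (κ : D.Crossing ≃ D'.Crossing) (ι : D.Arc ≃ D'.Arc)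
    (tm tb mb : D.Crossing) (σt σm σb : ℤˣ) (e₁ e₂ e₃ : D.Arc) : Prop where
  triangle : IsTriangle D tm tb mb σt σm σb e₁ e₂ e₃
  triangle' : IsTriangle D' (κ tm) (κ tb) (κ mb) (-σt) (-σm) (-σb) (ι e₁) (ι e₂) (ι e₃)
  sign_eq : ∀ c, D'.sign (κ c) = D.sign c
  over_tm : D'.overEnd (κ tm) σm = ι (D.overEnd tb (-σb))
  over_tb : D'.overEnd (κ tb) σb = ι (D.overEnd tm (-σm))
  under_tm : D'.underEnd (κ tm) σt = ι (D.overEnd mb (-σb))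
  over_mb : D'.overEnd (κ mb) σb = ι (D.underEnd tm (-σt))
  under_tb : D'.underEnd (κ tb) σt = ι (D.underEnd mb (-σm))
  under_mb : D'.underEnd (κ mb) σm = ι (D.underEnd tb (-σt))
  strandEnd_eq : ∀ c, c ≠ tm → c ≠ tb → c ≠ mb → ∀ t a,
    D'.strandEnd (κ c, t) a = ι (D.strandEnd (c, t) a)

namespace IsTriangleMove

variable {κ : D.Crossing ≃ D'.Crossing} {ι : D.Arc ≃ D'.Arc} {tm tb mb : D.Crossing}
  {σt σm σb : ℤˣ} {e₁ e₂ e₃ : D.Arc}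

theorem symm (h : IsTriangleMove D D' κ ι tm tb mb σt σm σb e₁ e₂ e₃) :
    IsTriangleMove D' D κ.symm ι.symm (κ tm) (κ tb) (κ mb) (-σt) (-σm) (-σb) (ι e₁) (ι e₂) (ι e₃)
    where
  triangle := h.triangle'
  triangle' := by simpa using h.triangle
  sign_eq c := by rw [← h.sign_eq, Equiv.apply_symm_apply]
  over_tm := by simp [h.over_tb]
  over_tb := by simp [h.over_tm]
  under_tm := by simp [h.over_mb]
  over_mb := by simp [h.under_tm]
  under_tb := by simp [h.under_mb]
  under_mb := by simp [h.under_tb]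
  strandEnd_eq c h₁ h₂ h₃ t a := by
    obtain ⟨c, rfl⟩ := κ.surjective c
    rw [h.strandEnd_eq c (fun e => h₁ (e ▸ rfl)) (fun e => h₂ (e ▸ rfl)) (fun e => h₃ (e ▸ rfl)),
      Equiv.symm_apply_apply, Equiv.symm_apply_apply]

/-- Colorings that agree outside the disc of the move are parts of the coloring of the same cube. -/
theorem fitsCube (h : IsTriangleMove D D' κ ι tm tb mb σt σm σb e₁ e₂ e₃)
    (f : D.Coloring X) (f' : D'.Coloring X)
    (hf : ∀ a, a ≠ e₁ ∧ a ≠ e₂ ∧ a ≠ e₃ → f.1 a = f'.1 (ι a)) {T M B : ℤˣ → ℤˣ → X}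
    (hc : IsCube T M B) (hD : IsTriangle.FitsCube D f.1 tm tb mb σt σm σb T M B) :
    IsTriangle.FitsCube D' f'.1 (κ tm) (κ tb) (κ mb) (-σt) (-σm) (-σb) T M B := by
  have t := h.triangle
  obtain ⟨a₁, a₂⟩ := IsFace.ext (f'.isColoredAt (κ tm)) (hc.top_middle (-σb)) σt σm
    (by rw [h.under_tm, ← hf _ t.outside_over_mb]; exact congrFun hD.over_mb _)
    (by rw [h.over_tm, ← hf _ t.outside_over_tb]; exact congrFun hD.over_tb _)
  obtain ⟨b₁, b₂⟩ := IsFace.ext (f'.isColoredAt (κ tb)) (hc.top_bottom (-σm)) σt σb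
    (by rw [h.under_tb, ← hf _ t.outside_under_mb]; exact congrFun hD.under_mb _)
    (by rw [h.over_tb, ← hf _ t.outside_over_tm]; exact congrFun hD.over_tm _)
  obtain ⟨c₁, c₂⟩ := IsFace.ext (f'.isColoredAt (κ mb)) (hc.middle_bottom (-σt)) σm σb
    (by rw [h.under_mb, ← hf _ t.outside_under_tb]; exact congrFun hD.under_tb _)
    (by rw [h.over_mb, ← hf _ t.outside_under_tm]; exact congrFun hD.under_tm _)
  exact ⟨a₂, a₁, b₂, b₁, c₂, c₁⟩

theorem existsUnique_agree [Finite X] (h : IsTriangleMove D D' κ ι tm tb mb σt σm σb e₁ e₂ e₃)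
    (f : D.Coloring X) : ∃! f' : D'.Coloring X,
      ∀ a, a ≠ e₁ ∧ a ≠ e₂ ∧ a ≠ e₃ → f.1 a = f'.1 (ι a) := by
  classical
  obtain ⟨T, M, B, hc, hD⟩ := h.triangle.exists_fitsCube f
  have t := h.triangle
  have t' := h.triangle'
  obtain ⟨h₁₂, h₁₃, h₂₃⟩ := t.sides_ne
  let g : D.Arc → X := fun a => if a = e₁ then T (-σm) (-σb) else
    if a = e₂ then M (-σt) (-σb) else if a = e₃ then B (-σt) (-σm) else f.1 a
  have g₁ : g e₁ = T (-σm) (-σb) := if_pos rfl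
  have g₂ : g e₂ = M (-σt) (-σb) := (if_neg h₁₂.symm).trans (if_pos rfl)
  have g₃ : g e₃ = B (-σt) (-σm) :=
    (if_neg h₁₃.symm).trans ((if_neg h₂₃.symm).trans (if_pos rfl))
  have g₀ : ∀ a, a ≠ e₁ ∧ a ≠ e₂ ∧ a ≠ e₃ → g a = f.1 a := fun a ha =>
    (if_neg ha.1).trans ((if_neg ha.2.1).trans (if_neg ha.2.2))
  have gι : ∀ a, g (ι.symm (ι a)) = g a := fun a => by rw [Equiv.symm_apply_apply]
  have hg : ∀ c', D'.IsColoredAt (fun a' => g (ι.symm a')) c' := by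
    intro c'
    obtain ⟨c, rfl⟩ := κ.surjective c'
    by_cases c₁ : c = tm
    · subst c₁
      unfold IsColoredAt
      convert hc.top_middle (-σb) using 1
      · refine units_funext_of σt ?_ ?_
        · refine (congrArg (fun x => g (ι.symm x)) h.under_tm).trans ?_
          rw [gι, g₀ _ t.outside_over_mb]
          exact congrFun hD.over_mb _
        · refine (congrArg (fun x => g (ι.symm x)) t'.under_tm).trans ?_
          rw [gι, g₂]
      · refine units_funext_of σm ?_ ?_
        · refine (congrArg (fun x => g (ι.symm x)) h.over_tm).trans ?_
          rw [gι, g₀ _ t.outside_over_tb]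
          exact congrFun hD.over_tb _
        · refine (congrArg (fun x => g (ι.symm x)) t'.over_tm).trans ?_
          rw [gι, g₁]
    by_cases c₂ : c = tb
    · subst c₂
      unfold IsColoredAt
      convert hc.top_bottom (-σm) using 1
      · refine units_funext_of σt ?_ ?_
        · refine (congrArg (fun x => g (ι.symm x)) h.under_tb).trans ?_
          rw [gι, g₀ _ t.outside_under_mb]
          exact congrFun hD.under_mb _
        · refine (congrArg (fun x => g (ι.symm x)) t'.under_tb).trans ?_
          rw [gι, g₃]
      · refine units_funext_of σb ?_ ?_
        · refine (congrArg (fun x => g (ι.symm x)) h.over_tb).trans ?_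
          rw [gι, g₀ _ t.outside_over_tm]
          exact congrFun hD.over_tm _
        · refine (congrArg (fun x => g (ι.symm x)) t'.over_tb).trans ?_
          rw [gι, g₁]
    by_cases c₃ : c = mb
    · subst c₃
      unfold IsColoredAt
      convert hc.middle_bottom (-σt) using 1
      · refine units_funext_of σm ?_ ?_
        · refine (congrArg (fun x => g (ι.symm x)) h.under_mb).trans ?_
          rw [gι, g₀ _ t.outside_under_tb]
          exact congrFun hD.under_tb _
        · refine (congrArg (fun x => g (ι.symm x)) t'.under_mb).trans ?_
          rw [gι, g₃]
      · refine units_funext_of σb ?_ ?_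
        · refine (congrArg (fun x => g (ι.symm x)) h.over_mb).trans ?_
          rw [gι, g₀ _ t.outside_under_tm]
          exact congrFun hD.under_tm _
        · refine (congrArg (fun x => g (ι.symm x)) t'.over_mb).trans ?_
          rw [gι, g₂]
    exact (f.isColoredAt c).of_strandEnd_eq fun s a => by
      rw [h.strandEnd_eq c c₁ c₂ c₃, Equiv.symm_apply_apply,
        g₀ _ (t.outside_of_ne c₁ c₂ c₃ s a)]
  refine ⟨Coloring.mk' _ hg, fun a ha => ?_, fun f' hf' => Subtype.ext ?_⟩
  · simp only [Coloring.mk', Equiv.symm_apply_apply]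
    exact (g₀ a ha).symm
  · have hD' := h.fitsCube f f' hf' hc hD
    funext a'
    obtain ⟨a, rfl⟩ := ι.surjective a'
    simp only [Coloring.mk', Equiv.symm_apply_apply]
    by_cases a₁ : a = e₁
    · rw [a₁, g₁, ← t'.over_tm]
      exact congrFun hD'.over_tm _
    by_cases a₂ : a = e₂
    · rw [a₂, g₂, ← t'.under_tm]
      exact congrFun hD'.under_tm _
    by_cases a₃ : a = e₃
    · rw [a₃, g₃, ← t'.under_tb]
      exact congrFun hD'.under_tb _
    rw [g₀ a ⟨a₁, a₂, a₃⟩, hf' a ⟨a₁, a₂, a₃⟩]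

theorem matchingCount_map (S : Setoid D.Arc) (a b c d p q : D.Arc) :
    matchingCount (S.map ι) (ι a) (ι b) (ι c) (ι d) (ι p) (ι q) = matchingCount S a b c d p q := by
  unfold matchingCount
  rw [← Setoid.map_joinPair, ← Setoid.map_joinPair, ← Setoid.map_joinPair, ← Setoid.map_sup,
    ← Setoid.map_sup, ← Setoid.map_sup, classCount_map_equiv]

theorem matchingCount_eq_of_forall {V : Type*} {S : Setoid V} {a b c d p q a' b' c' d' p' q' : V}
    (h : ∀ Y : Setoid V,
      (Quotient.mk Y a = Quotient.mk Y b ∧ Quotient.mk Y c = Quotient.mk Y d ∧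
        Quotient.mk Y p = Quotient.mk Y q) ↔
      (Quotient.mk Y a' = Quotient.mk Y b' ∧ Quotient.mk Y c' = Quotient.mk Y d' ∧
        Quotient.mk Y p' = Quotient.mk Y q')) :
    matchingCount S a b c d p q = matchingCount S a' b' c' d' p' q' := by
  unfold matchingCount
  rw [eq_of_forall_ge_iff (a := S ⊔ joinPair a b ⊔ joinPair c d ⊔ joinPair p q)
    (b := S ⊔ joinPair a' b' ⊔ joinPair c' d' ⊔ joinPair p' q') fun Y => by
      simp only [sup_le_iff, joinPair_le_iff_mk_eq, and_assoc]
      exact and_congr_right fun _ => h Y]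

theorem bracketValue_eq [Finite X] (h : IsTriangleMove D D' κ ι tm tb mb σt σm σb e₁ e₂ e₃)
    (β : BiquandleBracket X R) (f : D.Coloring X) (f' : D'.Coloring X)
    (hf : ∀ a, a ≠ e₁ ∧ a ≠ e₂ ∧ a ≠ e₃ → f.1 a = f'.1 (ι a)) :
    D.bracketValue β f = D'.bracketValue β f' := by
  classical
  obtain ⟨T, M, B, hc, hD⟩ := h.triangle.exists_fitsCube f
  have hD' := h.fitsCube f f' hf hc hD
  have t := h.triangle
  have hw : D'.negWrithe = D.negWrithe := by
    rw [negWrithe_eq, negWrithe_eq, ← Equiv.sum_comp κ]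
    simp only [h.sign_eq]
  let C₀ := {c : D.Crossing // c ≠ tm ∧ c ≠ tb ∧ c ≠ mb}
  have hbij : Function.Bijective
      (Sum.elim (fun c : C₀ => c.1) ![tm, tb, mb]) := by
    constructor
    · refine Subtype.val_injective.sumElim ?_ ?_
      · intro i j hij
        fin_cases i <;> fin_cases j <;>
          simp [t.tm_ne_tb, t.tm_ne_mb, t.tb_ne_mb, t.tm_ne_tb.symm, t.tm_ne_mb.symm,
            t.tb_ne_mb.symm] at hij ⊢
      · rintro ⟨c, h₁, h₂, h₃⟩ i hi
        fin_cases i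
        · exact h₁ hi
        · exact h₂ hi
        · exact h₃ hi
    · intro c
      by_cases c₁ : c = tm
      · exact ⟨.inr 0, c₁.symm⟩
      by_cases c₂ : c = tb
      · exact ⟨.inr 1, c₂.symm⟩
      by_cases c₃ : c = mb
      · exact ⟨.inr 2, c₃.symm⟩
      exact ⟨.inl ⟨c, c₁, c₂, c₃⟩, rfl⟩
  let e : C₀ ⊕ Fin 3 ≃ D.Crossing := Equiv.ofBijective _ hbij
  have hcoeff : ∀ (c : C₀) s, D'.smoothingCoeff β f' (κ c.1) s = D.smoothingCoeff β f c.1 s := by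
    rintro ⟨c, h₁, h₂, h₃⟩ s
    rw [smoothingCoeff_eq, smoothingCoeff_eq, underEnd, overEnd, h.strandEnd_eq c h₁ h₂ h₃,
      h.strandEnd_eq c h₁ h₂ h₃, ← hf _ (t.outside_of_ne h₁ h₂ h₃ _ _),
      ← hf _ (t.outside_of_ne h₁ h₂ h₃ _ _), h.sign_eq]
  have hid := (triangleWeights_of_isCube β hc).triangleIdentity (D.sign tm) σt σm σb
  -- The sides of the triangle change, but a smoothing joins the opposite sides as well.
  have jn : ∀ a b, Smoothing.joining (-a) (-b) = Smoothing.joining a b := fun a b => by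
    simp only [Smoothing.joining, neg_inj]
  have jn' : ∀ a b, Smoothing.joining (-a) b = Smoothing.joining a (-b) := fun a b => by
    rw [← jn a (-b), neg_neg]
  have hk := hD.smoothingCoeff (β := β)
  have hk' := hD'.smoothingCoeff (β := β)
  simp only [h.sign_eq, t.sign_tb, t.sign_mb] at hk hk'
  rw [LinkDiagram.bracketValue_eq, LinkDiagram.bracketValue_eq, hw, stateSum_eq_sum e,
    stateSum_eq_sum (e.trans κ)]
  congr 1
  refine Finset.sum_congr rfl fun s _ => ?_
  simp only [e, Equiv.trans_apply, Equiv.ofBijective_apply, Sum.elim_inl, Sum.elim_inr, hcoeff,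
    bot_sup_eq]
  congr 1
  have hS : (⨆ c : C₀, D'.smoothingSetoid (κ c.1) (s c)) =
      (⨆ c : C₀, D.smoothingSetoid c.1 (s c)).map ι := by
    rw [Setoid.map_iSup]
    exact iSup_congr fun c => (map_smoothingSetoid
      (h.strandEnd_eq c.1 c.2.1 c.2.2.1 c.2.2.2) (s c)).symm
  have iso : ∀ x, (x = e₁ ∨ x = e₂ ∨ x = e₃) →
      Isolated (⨆ c : C₀, D.smoothingSetoid c.1 (s c)) x ∧
        Isolated (⨆ c : C₀, D'.smoothingSetoid (κ c.1) (s c)) (ι x) := by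
    intro x hx
    have ne : ∀ (c : C₀) u a, D.strandEnd (c.1, u) a ≠ x := fun c u a => by
      obtain ⟨n₁, n₂, n₃⟩ := t.outside_of_ne c.2.1 c.2.2.1 c.2.2.2 u a
      rcases hx with rfl | rfl | rfl <;> assumption
    exact ⟨isolated_iSup fun c => isolated_smoothingSetoid (ne c) _,
      isolated_iSup fun c => isolated_smoothingSetoid (fun u a hua => ne c u a (ι.injective
        ((h.strandEnd_eq c.1 c.2.1 c.2.2.1 c.2.2.2 u a).symm.trans hua))) _⟩
  have i₁ := iso e₁ (.inl rfl)
  have i₂ := iso e₂ (.inr (.inl rfl))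
  have i₃ := iso e₃ (.inr (.inr rfl))
  have v : ∀ i, κ (![tm, tb, mb] i) = ![κ tm, κ tb, κ mb] i := fun i => by fin_cases i <;> rfl
  simp only [v]
  rw [t.stateSum_eq i₁.1 i₂.1 i₃.1 β.δ (fun c t => (D.smoothingCoeff β f c t : R))
      (congrArg Units.val (hk _).1) (congrArg Units.val (hk _).1)
      (congrArg Units.val (hk _).2.1) (congrArg Units.val (hk _).2.1)
      (congrArg Units.val (hk _).2.2) (congrArg Units.val (hk _).2.2),
    h.triangle'.stateSum_eq i₁.2 i₂.2 i₃.2 β.δ (fun c t => (D'.smoothingCoeff β f' c t : R))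
      (congrArg Units.val (hk' _).1) (congrArg Units.val (hk' _).1)
      (congrArg Units.val (hk' _).2.1) (congrArg Units.val (hk' _).2.1)
      (congrArg Units.val (hk' _).2.2) (congrArg Units.val (hk' _).2.2)]
  simp only [jn, jn', neg_neg σt, neg_neg σm, neg_neg σb, h.over_tm, h.over_tb, h.under_tm,
    h.over_mb, h.under_tb, h.under_mb]
  rw [hS]
  simp only [matchingCount_map]
  generalize (⨆ c : C₀, D.smoothingSetoid c.1 (s c)) = S
  generalize D.overEnd tm (-σm) = T₁
  generalize D.underEnd tm (-σt) = M₁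
  generalize D.overEnd tb (-σb) = T₂
  generalize D.underEnd tb (-σt) = B₂
  generalize D.overEnd mb (-σb) = M₃
  generalize D.underEnd mb (-σm) = B₃
  -- The states that cut off at least two corners before the move join the outer ends as the state
  -- that cuts off none does after it, and vice versa; the other three matchings are unchanged.
  rw [matchingCount_eq_of_forall (S := S) (a := M₃) (b := T₂) (c := B₃) (d := T₁) (p := B₂)
      (q := M₁) (a' := T₁) (b' := B₃) (c' := M₁) (d' := B₂) (p' := T₂) (q' := M₃)
      (fun Y => by grind),
    matchingCount_eq_of_forall (S := S) (a := M₃) (b := T₂) (c := T₁) (d := M₁) (p := B₃)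
      (q := B₂) (a' := M₁) (b' := T₁) (c' := T₂) (d' := M₃) (p' := B₂) (q' := B₃)
      (fun Y => by grind),
    matchingCount_eq_of_forall (S := S) (a := B₃) (b := T₁) (c := T₂) (d := B₂) (p := M₃)
      (q := M₁) (a' := B₂) (b' := T₂) (c' := T₁) (d' := B₃) (p' := M₁) (q' := M₃)
      (fun Y => by grind),
    matchingCount_eq_of_forall (S := S) (a := B₂) (b := M₁) (c := T₂) (d := T₁) (p := M₃)
      (q := B₃) (a' := B₃) (b' := M₃) (c' := T₁) (d' := T₂) (p' := M₁) (q' := B₂)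
      (fun Y => by grind),
    matchingCount_eq_of_forall (S := S) (a := T₂) (b := B₂) (c := M₃) (d := B₃) (p := T₁)
      (q := M₁) (a' := M₁) (b' := T₁) (c' := B₂) (d' := T₂) (p' := B₃) (q' := M₃)
      (fun Y => by grind)]
  rw [hid.cut_most, hid.cut₁, hid.cut₂, hid.cut₃, hid.cut_none]
  ring

end IsTriangleMove
end TriangleMove
/-! ### Invariance under a single move -/

section Moves

variable {X : Type*} [Biquandle X] {R : Type*} [CommRing R] {D D' : LinkDiagram}

theorem IsTriangleMove.coloredInvariance [Finite X] (β : BiquandleBracket X R)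
    {κ : D.Crossing ≃ D'.Crossing} {ι : D.Arc ≃ D'.Arc} {tm tb mb : D.Crossing} {σt σm σb : ℤˣ}
    {e₁ e₂ e₃ : D.Arc} (h : IsTriangleMove D D' κ ι tm tb mb σt σm σb e₁ e₂ e₃)
    {r : D.Arc → D'.Arc → Prop} (hr : ∀ a a', r a a' ↔ (a ≠ e₁ ∧ a ≠ e₂ ∧ a ≠ e₃) ∧ a' = ι a) :
    ColoredInvariance β D D' r := by
  have agree : ∀ (f : D.Coloring X) (f' : D'.Coloring X), Coloring.Agree r f f' ↔
      ∀ a, a ≠ e₁ ∧ a ≠ e₂ ∧ a ≠ e₃ → f.1 a = f'.1 (ι a) := fun f f' =>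
    ⟨fun hf a ha => hf a _ ((hr _ _).2 ⟨ha, rfl⟩), fun hf a a' haa' => by
      obtain ⟨ha, rfl⟩ := (hr _ _).1 haa'
      exact hf a ha⟩
  have agree' : ∀ (f : D.Coloring X) (f' : D'.Coloring X), Coloring.Agree r f f' ↔
      ∀ a', a' ≠ ι e₁ ∧ a' ≠ ι e₂ ∧ a' ≠ ι e₃ → f'.1 a' = f.1 (ι.symm a') := fun f f' => by
    rw [agree, ι.forall_congr_left]
    refine forall_congr' fun a' => ?_
    rw [Equiv.apply_symm_apply, eq_comm, ne_eq, ne_eq, ne_eq, Equiv.symm_apply_eq,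
      Equiv.symm_apply_eq, Equiv.symm_apply_eq]
  refine ⟨fun f => ?_, fun f' => ?_, fun f f' hf => h.bracketValue_eq β f f' ((agree f f').1 hf)⟩
  · simpa only [agree] using h.existsUnique_agree f
  · simpa only [agree'] using h.symm.existsUnique_agree f'

theorem consecutive_iff {ε : ℤˣ} {p q : D.Crossing × Strand} {a : D.Arc} :
    D.Consecutive ε p q a ↔
      D.strandEnd p (-ε * D.innSide p) = a ∧ D.strandEnd q (ε * D.innSide q) = a := by
  unfold Consecutive
  rcases Int.units_eq_one_or ε with rfl | rfl
  · rw [if_pos rfl, one_mul, neg_one_mul, strandEnd_innSide, strandEnd_neg_innSide]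
  · rw [if_neg (by decide), neg_neg, one_mul, neg_one_mul, strandEnd_innSide, strandEnd_neg_innSide,
      and_comm]

/-- A rewiring in terms of left and right ends: incoming ends go to incoming ends, on a possibly
different side. -/
theorem IsRewiring.strandEnd_eq {τ : Equiv.Perm (D.Crossing × Strand)}
    {κ : D.Crossing ≃ D'.Crossing} {ι : D.Arc ≃ D'.Arc} (h : IsRewiring D D' τ κ ι)
    (p : D.Crossing × Strand) (a : ℤˣ) :
    D'.strandEnd (κ p.1, p.2) a = ι (D.strandEnd (τ p) (a * (D.innSide p * D.innSide (τ p)))) := by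
  have hs : D'.innSide (κ p.1, p.2) = D.innSide p := by
    obtain ⟨c, _ | _⟩ := p <;> simp [innSide, h.sign_eq]
  rcases units_eq_or_eq_neg a (D.innSide p) with rfl | rfl
  · rw [← mul_assoc, Int.units_mul_self, one_mul, strandEnd_innSide, ← h.inn_eq, ← hs,
      strandEnd_innSide]
  · rw [← mul_assoc, neg_mul, Int.units_mul_self, neg_one_mul, strandEnd_neg_innSide, ← h.out_eq,
      ← hs, strandEnd_neg_innSide]

/-- The exchange of places in `triangleSwap` is a triangle move. The signs and `η` give the sides of
the strands on which the triangle lies. -/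
theorem isTriangleMove_of_isRewiring {κ : D.Crossing ≃ D'.Crossing} {ι : D.Arc ≃ D'.Arc}
    {tm tb mb : D.Crossing} (tm_ne_tb : tm ≠ tb) (tm_ne_mb : tm ≠ mb) (tb_ne_mb : tb ≠ mb)
    (η : ℤˣ) {e₁ e₂ e₃ : D.Arc}
    (top : D.Consecutive (η * D.sign tb) (tm, .upper) (tb, .upper) e₁)
    (middle : D.Consecutive (η * D.sign mb) (tm, .lower) (mb, .upper) e₂)
    (bottom : D.Consecutive (η * D.sign tm * D.sign tb * D.sign mb) (tb, .lower) (mb, .lower) e₃)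
    (h : IsRewiring D D' (D.triangleSwap tm tb mb) κ ι) :
    IsTriangleMove D D' κ ι tm tb mb (-(η * D.sign mb * D.sign tm)) (η * D.sign tb * D.sign tm) (-η)
      e₁ e₂ e₃ := by
  classical
  have s₁ : D.triangleSwap tm tb mb (tm, .upper) = (tb, .upper) := by
    simp [triangleSwap, Equiv.swap_apply_def, tm_ne_tb, tm_ne_mb]
  have s₂ : D.triangleSwap tm tb mb (tb, .upper) = (tm, .upper) := by
    simp [triangleSwap, Equiv.swap_apply_def, tb_ne_mb]
  have s₃ : D.triangleSwap tm tb mb (tm, .lower) = (mb, .upper) := by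
    simp [triangleSwap, Equiv.swap_apply_def, tm_ne_tb, tm_ne_mb, tm_ne_mb.symm, tb_ne_mb.symm]
  have s₄ : D.triangleSwap tm tb mb (mb, .upper) = (tm, .lower) := by
    simp [triangleSwap, Equiv.swap_apply_def, tm_ne_tb]
  have s₅ : D.triangleSwap tm tb mb (tb, .lower) = (mb, .lower) := by
    simp [triangleSwap, Equiv.swap_apply_def, tm_ne_mb.symm]
  have s₆ : D.triangleSwap tm tb mb (mb, .lower) = (tb, .lower) := by
    simp [triangleSwap, Equiv.swap_apply_def, tm_ne_tb.symm]
  have s₀ : ∀ c, c ≠ tm → c ≠ tb → c ≠ mb → ∀ t, D.triangleSwap tm tb mb (c, t) = (c, t) := by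
    intro c h₁ h₂ h₃ t
    simp [triangleSwap, Equiv.swap_apply_def, h₁, h₂, h₃]
  have r₁ := h.strandEnd_eq (tm, .upper)
  have r₂ := h.strandEnd_eq (tb, .upper)
  have r₃ := h.strandEnd_eq (tm, .lower)
  have r₄ := h.strandEnd_eq (mb, .upper)
  have r₅ := h.strandEnd_eq (tb, .lower)
  have r₆ := h.strandEnd_eq (mb, .lower)
  rw [s₁] at r₁
  rw [s₂] at r₂
  rw [s₃] at r₃
  rw [s₄] at r₄
  rw [s₅] at r₅
  rw [s₆] at r₆
  rw [consecutive_iff] at top middle bottom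
  simp only [innSide] at r₁ r₂ r₃ r₄ r₅ r₆ top middle bottom
  have sgn := h.sign_eq
  generalize hx : D.sign tm = x at *
  generalize hy : D.sign tb = y at *
  generalize hz : D.sign mb = z at *
  -- The products of signs that occur in the three sides and in the images of the twelve ends.
  have q : ∀ η x y z : ℤˣ, -(η * y) * -x = η * y * x ∧ η * y * -y = -η ∧
      -(η * z) * x = -(η * z * x) ∧ η * z * -z = -η ∧ -(η * x * y * z) * y = -(η * z * x) ∧
      η * x * y * z * z = η * y * x ∧ y = - -η * (η * y * x) * x ∧ z = -η * -(η * z * x) * x := by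
    decide
  have q' : ∀ η x y z : ℤˣ, -(η * y * x) * (-x * -y) = -η ∧ - -η * (-y * -x) = η * y * x ∧
      - -(η * z * x) * (x * -z) = -η ∧ - -η * (-z * x) = -(η * z * x) ∧
      - -(η * z * x) * (y * z) = η * y * x ∧ -(η * y * x) * (z * y) = -(η * z * x) := by
    decide
  have q'' : ∀ η x y z : ℤˣ, η * y * x * (-x * -y) = - -η ∧ -η * (-y * -x) = -(η * y * x) ∧
      -(η * z * x) * (x * -z) = - -η ∧ -η * (-z * x) = - -(η * z * x) ∧
      -(η * z * x) * (y * z) = -(η * y * x) ∧ η * y * x * (z * y) = - -(η * z * x) := by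
    decide
  obtain ⟨q₁, q₂, q₃, q₄, q₅, q₆, q₇, q₈⟩ := q η x y z
  obtain ⟨q₁', q₂', q₃', q₄', q₅', q₆'⟩ := q' η x y z
  obtain ⟨q₁'', q₂'', q₃'', q₄'', q₅'', q₆''⟩ := q'' η x y z
  rw [q₁, q₂] at top
  rw [q₃, q₄] at middle
  rw [q₅, q₆] at bottom
  refine ⟨⟨tm_ne_tb, tm_ne_mb, tb_ne_mb, ?_, ?_, top.1, top.2, middle.1, middle.2, bottom.1,
    bottom.2⟩, ⟨κ.injective.ne tm_ne_tb, κ.injective.ne tm_ne_mb, κ.injective.ne tb_ne_mb, ?_, ?_,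
      ?_, ?_, ?_, ?_, ?_, ?_⟩, sgn, ?_, ?_, ?_, ?_, ?_, ?_, ?_⟩
  · rwa [hy, hx]
  · rwa [hz, hx]
  · rw [sgn, sgn, hy, hx]
    simpa using q₇
  · rw [sgn, sgn, hz, hx]
    simpa using q₈
  · exact (r₁ _).trans (congrArg ι ((congrArg _ q₁').trans top.2))
  · exact (r₂ _).trans (congrArg ι ((congrArg _ q₂').trans top.1))
  · exact (r₃ _).trans (congrArg ι ((congrArg _ q₃').trans middle.2))
  · exact (r₄ _).trans (congrArg ι ((congrArg _ q₄').trans middle.1))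
  · exact (r₅ _).trans (congrArg ι ((congrArg _ q₅').trans bottom.2))
  · exact (r₆ _).trans (congrArg ι ((congrArg _ q₆').trans bottom.1))
  · exact (r₁ _).trans (congrArg ι (congrArg _ q₁''))
  · exact (r₂ _).trans (congrArg ι (congrArg _ q₂''))
  · exact (r₃ _).trans (congrArg ι (congrArg _ q₃''))
  · exact (r₄ _).trans (congrArg ι (congrArg _ q₄''))
  · exact (r₅ _).trans (congrArg ι (congrArg _ q₅''))
  · exact (r₆ _).trans (congrArg ι (congrArg _ q₆''))
  · intro c h₁ h₂ h₃ t a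
    have := h.strandEnd_eq (c, t) a
    rwa [s₀ c h₁ h₂ h₃, Int.units_mul_self, mul_one] at this

end Moves
section Invariance

variable {X : Type*} [Biquandle X] {R : Type*} [CommRing R] {D D' : LinkDiagram}

/-- A renaming erases no crossings. -/
theorem IsRewiring.isErasure {κ : D.Crossing ≃ D'.Crossing} {ι : D.Arc ≃ D'.Arc}
    (h : IsRewiring D D' 1 κ ι) : IsErasure D D' ∅ κ ι.symm where
  injective := κ.injective
  range_eq := by rw [κ.surjective.range_eq, Set.compl_empty]
  surjective := ι.symm.surjective
  eq_iff a b := by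
    rw [ι.symm.injective.eq_iff]
    refine ⟨fun e => e ▸ .refl _, fun e => ?_⟩
    induction e with
    | rel _ _ e => exact absurd e.choose_spec.1 (Set.notMem_empty _)
    | refl => rfl
    | symm _ _ _ e => exact e.symm
    | trans _ _ _ _ _ e e' => exact e.trans e'
  sign_eq c := (h.sign_eq c).symm
  inn_eq c t := by rw [h.inn_eq (c, t), Equiv.symm_apply_apply]; rfl
  out_eq c t := by rw [h.out_eq (c, t), Equiv.symm_apply_apply]; rfl

theorem stateSum_of_isEmpty {V C : Type*} [Fintype C] [IsEmpty C] (δ : R) (S : Setoid V)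
    (J : C → Smoothing → Setoid V) (k : C → Smoothing → R) :
    stateSum δ S J k = δ ^ classCount S := by
  classical
  rw [stateSum_eq, Fintype.sum_unique]
  simp

theorem coloredInvariance_rename (β : BiquandleBracket X R) {κ : D.Crossing ≃ D'.Crossing}
    {ι : D.Arc ≃ D'.Arc} (h : IsRewiring D D' 1 κ ι) :
    ColoredInvariance β D D' fun a a' => a' = ι a := by
  have hr : ∀ a a', a' = ι a ↔ True ∧ a = ι.symm a' := fun a a' => by
    rw [true_and, Equiv.eq_symm_apply, eq_comm]
  have hker : Setoid.ker ι.symm = ⊥ := Setoid.ker_eq_bot_iff.2 ι.symm.injective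
  have hcol : _ ∧ _ := h.isErasure.existsUnique_agree (X := X) hr (fun _ _ _ => trivial)
    (fun x => ⟨x, trivial, rfl⟩) (fun g => ⟨g ∘ ι.symm, fun _ _ => rfl, fun _ hc => hc.elim⟩)
    (fun f₁ f₂ h₁₂ _ _ => funext fun a => h₁₂ a trivial)
    (fun f' _ => ⟨f', hker.le.trans bot_le, fun _ _ => rfl⟩)
  refine ⟨hcol.1, hcol.2, fun f f' hf => ?_⟩
  refine h.isErasure.bracketValue_eq (I := Empty) Empty.elim (fun i => i.elim)
    (Set.range_eq_empty _) hr (fun _ _ _ => trivial) β f f' hf fun T _ => ?_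
  rw [stateSum_of_isEmpty, hker, sup_bot_eq]
  simp

/-- Colorings of diagrams related by a move correspond to each other, with the same values. -/
theorem ReidemeisterMove.coloredInvariance [Finite X] (β : BiquandleBracket X R)
    {r : D.Arc → D'.Arc → Prop} (h : ReidemeisterMove D D' r) : ColoredInvariance β D D' r := by
  cases h with
  | rename h => exact coloredInvariance_rename β h
  | typeI c t curl h =>
    cases t with
    | upper =>
      exact coloredInvariance_kink β (α := D'.sign c) ((D'.underEnd_sign c).trans curl.symm)
        (D'.overEnd_sign c) h fun _ _ => Iff.rfl
    | lower =>
      exact coloredInvariance_kink β (α := -D'.sign c) (D'.underEnd_neg_sign c)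
        ((D'.overEnd_neg_sign c).trans curl.symm) h fun _ _ => Iff.rfl
  | directTypeII c₁ c₂ sign overPass underPass h =>
    have hs : D'.sign c₁ = -D'.sign c₂ := by rw [sign, neg_neg]
    exact coloredInvariance_bigon β (α := D'.sign c₁) (γ := -D'.sign c₁) sign
      (D'.overEnd_sign c₁) (by rw [hs, overEnd_neg_sign, overPass])
      (D'.underEnd_neg_sign c₁) (by rw [← sign, underEnd_sign, underPass]) h
      fun _ _ => and_assoc.symm
  | reverseTypeII c₁ c₂ sign overPass underPass h =>
    have hs : D'.sign c₁ = -D'.sign c₂ := by rw [sign, neg_neg]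
    exact coloredInvariance_bigon β (α := D'.sign c₁) (γ := D'.sign c₁) sign
      (D'.overEnd_sign c₁) (by rw [hs, overEnd_neg_sign, overPass])
      ((D'.underEnd_sign c₁).trans underPass.symm) (by rw [hs, underEnd_neg_sign]) h
      fun _ _ => and_assoc.symm
  | typeIII tm tb mb tm_ne_tb tm_ne_mb tb_ne_mb η e₁ e₂ e₃ top middle bottom h =>
    exact (isTriangleMove_of_isRewiring tm_ne_tb tm_ne_mb tb_ne_mb η top middle bottom
      h).coloredInvariance β fun _ _ => by simp only [and_assoc]

/-! ### Invariants of links -/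

/-- The correspondence of colorings is a bijection that preserves values. -/
theorem ColoredInvariance.exists_equiv {β : BiquandleBracket X R} {r : D.Arc → D'.Arc → Prop}
    (h : ColoredInvariance β D D' r) :
    ∃ e : D.Coloring X ≃ D'.Coloring X, ∀ f, D'.bracketValue β (e f) = D.bracketValue β f := by
  obtain ⟨h₁, h₂, h₃⟩ := h
  choose φ hφ hφ' using h₁
  choose ψ hψ hψ' using h₂
  exact ⟨⟨φ, ψ, fun f => (hψ' _ _ (hφ f)).symm, fun f' => (hφ' _ _ (hψ f')).symm⟩,
    fun f => (h₃ _ _ (hφ f)).symm⟩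

theorem ReidemeisterMove.bracket_eq [Finite X] (β : BiquandleBracket X R)
    {r : D.Arc → D'.Arc → Prop} (h : ReidemeisterMove D D' r) :
    D.bracketMultiset β = D'.bracketMultiset β ∧
      D.bracketPolynomial β = D'.bracketPolynomial β := by
  obtain ⟨e, he⟩ := (h.coloredInvariance β).exists_equiv
  constructor
  · unfold bracketMultiset
    rw [← Finset.univ_map_equiv_to_embedding e, Finset.map_val, Multiset.map_map]
    exact Multiset.map_congr rfl fun f _ => (he f).symm
  · unfold bracketPolynomial
    exact Fintype.sum_equiv e _ _ fun f => by rw [he]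

theorem ReidemeisterEquiv.bracket_eq [Finite X] (β : BiquandleBracket X R)
    (h : ReidemeisterEquiv D D') :
    D.bracketMultiset β = D'.bracketMultiset β ∧
      D.bracketPolynomial β = D'.bracketPolynomial β := by
  induction h with
  | rel _ _ h => exact h.choose_spec.bracket_eq β
  | refl => exact ⟨rfl, rfl⟩
  | symm _ _ _ h => exact ⟨h.1.symm, h.2.symm⟩
  | trans _ _ _ _ _ h h' => exact ⟨h.1.trans h'.1, h.2.trans h'.2⟩

end Invariance
end LinkDiagram

theorem mainTheorem1 {X : Type*} [Finite X] [Biquandle X] {R : Type*} [CommRing R]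
    (β : BiquandleBracket X R) :
    (∀ (D D' : LinkDiagram) (r : D.Arc → D'.Arc → Prop), LinkDiagram.ReidemeisterMove D D' r →
      (∀ f : D.Coloring X, ∃! f' : D'.Coloring X, LinkDiagram.Coloring.Agree r f f') ∧
      (∀ f' : D'.Coloring X, ∃! f : D.Coloring X, LinkDiagram.Coloring.Agree r f f') ∧
      (∀ (f : D.Coloring X) (f' : D'.Coloring X), LinkDiagram.Coloring.Agree r f f' →
        D.bracketValue β f = D'.bracketValue β f')) ∧
    (∀ D D' : LinkDiagram, LinkDiagram.ReidemeisterEquiv D D' →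
      D.bracketMultiset β = D'.bracketMultiset β ∧
      D.bracketPolynomial β = D'.bracketPolynomial β) ∧
    (∃ (Φ : OrientedLink → Multiset R) (P : OrientedLink → AddMonoidAlgebra ℤ R),
      ∀ D : {D : LinkDiagram // D.IsPlanar},
        Φ (OrientedLink.ofDiagram D) = D.1.bracketMultiset β ∧
        P (OrientedLink.ofDiagram D) = D.1.bracketPolynomial β) :=
  ⟨fun _ _ _ h => h.coloredInvariance β, fun _ _ h => h.bracket_eq β,
    Quot.lift (fun D => D.1.bracketMultiset β) fun _ _ h => (h.choose_spec.bracket_eq β).1,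
    Quot.lift (fun D => D.1.bracketPolynomial β) fun _ _ h => (h.choose_spec.bracket_eq β).2,
    fun _ => ⟨rfl, rfl⟩⟩
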